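/- Let $d\ge 1$ and let $\omega$ be a self-similar tile-substitution in $\mathbb R^d$: there are prototiles $T_j=(A_j,j)$, $1\le j\le m$, where each $A_j\subset\mathbb R^d$ is nonempty, compact and the closure of its interior; an expansion $\phi$, a linear map with $|\phi x|=\lambda|x|$ for all $x$, where $\lambda>1$; and for each $j$ a finite set $\omega(T_j)$ of translates of prototiles with pairwise disjoint interiors and union $\phi A_j$. It is extended by $\omega(T_j+x)=\omega(T_j)+\phi x$. Let $\mathsf S_{ij}$ be the number of tiles of type $i$ in $\omega(T_j)$, and let $X_\omega$ be the set of tilings of $\mathbb R^d$ each of whose finite patches is a translate of a subpatch of some $\omega^n(T_j)$. Assume that $\omega$ is primitive (some positive power of $\mathsf S$ has only positive entries), has finite local complexity (for each $R>0$ the subpatches of diameter less than $R$ of all the $\omega^n(T_j)$ form finitely many classes up to translation) and is non-periodic (if $\mathcal T\in X_\omega$ and $\mathcal T-y=\mathcal T$, then $y=0$). For $\mathcal T\in X_\omega$ and $k\in\mathbb Z$ let $\mathcal T^{(k)}$ be the tiling of order $k$ associated with $\mathcal T$: $\mathcal T^{(k)}=\phi^{k}\omega^{-k}(\mathcal T)$,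 where for $k>0$ the symbol $\omega^{-k}(\mathcal T)$ denotes the unique $\mathcal R\in X_\omega$ with $\omega^k(\mathcal R)=\mathcal T$. Let $\partial\mathcal T^{(k)}$ be the union of the boundaries of its tiles, and for $\Omega\subset\mathbb R^d$ let $\mathcal T^{(k)}|_\Omega$ be the collection of tiles of $\mathcal T^{(k)}$ contained in $\Omega$. Let $\mathcal C^+_{\mathcal T}$ be the ring of all sets $(\operatorname{supp}(P)\setminus N_1)\cup N_2$, where for some $k\in\mathbb Z$, $P\subset\mathcal T^{(k)}$ is finite and $N_1,N_2\subset\partial\mathcal T^{(k)}$. A bounded open set $\Omega\subset\mathbb R^d$ is called a Lipschitz domain if there are finitely many Lipschitz maps $h_i:\mathbb R^{d-1}\to\mathbb R^d$ with $\mathcal H^{d-1}\bigl(\partial\Omega\setminus\bigcup_i h_i(\mathbb R^{d-1})\bigr)=0$ and there is a constant $C$ with $\mathcal L^d(\{x:\operatorname{dist}(x,\partial\Omega)\le r\})\le Cr$ for all $0<r\le 1$. Let $\mathcal Q$ be the ring of sets (closed under finite unions and differences) generated by the Lipschitz domains and all subsets of their boundaries. Let $E^{++}\subset\mathbb C^m$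 be the span of the generalized eigenspaces of $\mathsf S^t$ for the eigenvalues $\theta$ with $|\theta|>\lambda^{d-1}$; $\mathsf S^t$ is invertible on $E^{++}$. Then for all $v\in E^{++}$ and $\mathcal T\in X_\omega$ there are a finitely-additive complex measure $\Psi_{v,\mathcal T}$ on $\mathcal C^+_{\mathcal T}$ and a finitely-additive complex measure $\Phi^+_{v,\mathcal T}$ on $\mathcal Q$ such that for all $v\in E^{++}$ and $\mathcal T\in X_\omega$: 1. $\Psi_{v,\mathcal T}(\operatorname{supp}T)=((\mathsf S^t)^kv)_j$ for every $k\in\mathbb Z$ and every tile $T\in\mathcal T^{(k)}$ of type $j$, and $\Psi_{v,\mathcal T}(N)=0$ for every $N\subset\partial\mathcal T^{(k)}$; 2. for every Lipschitz domain $\Omega$, the limit $\lim_{k\to-\infty}\Psi_{v,\mathcal T}(\operatorname{supp}(\mathcal T^{(k)}|_\Omega))$ exists and equals $\Phi^+_{v,\mathcal T}(\Omega)$, and $\Phi^+_{v,\mathcal T}(\Omega\cup N)=\Phi^+_{v,\mathcal T}(\Omega)$ for every $N\subset\partial\Omega$; 3. $\Phi^+_{v,\mathcal T}=\Psi_{v,\mathcal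 T}$ on $\mathcal C^+_{\mathcal T}\cap\mathcal Q$; 4. for every $\Omega\in\mathcal Q$: $\Phi^+_{v,\mathcal T-y}(\Omega)=\Phi^+_{v,\mathcal T}(\Omega+y)$ for all $y\in\mathbb R^d$, and $\Phi^+_{\mathsf S^tv,\mathcal T}(\Omega)=\Phi^+_{v,\omega(\mathcal T)}(\phi(\Omega))$; in particular, if $\mathsf S^tv=\theta v$, then $\Phi^+_{v,\omega(\mathcal T)}(\phi(\Omega))=\Phi^+_{\theta v,\mathcal T}(\Omega)=\theta\,\Phi^+_{v,\mathcal T}(\Omega)$. -/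

import Mathlib

open Set Filter Topology MeasureTheory

noncomputable section

/-! ## Lipschitz domains and the ring they generate -/

/-- A bounded open set whose boundary is `(d-1)`-rectifiable, i.e. covered up to an
`ℋ^{d-1}`-null set by finitely many Lipschitz images of `ℝ^{d-1}`, and has finite
`(d-1)`-dimensional upper Minkowski content, i.e. the closed `r`-neighbourhood of the boundary
has volume `O(r)`. -/
structure IsLipschitzDomain {d : ℕ} (Ω : Set (EuclideanSpace ℝ (Fin d))) : Prop where
  isOpen : IsOpen Ω
  isBounded : Bornology.IsBounded Ω
  rectifiable : ∃ (N : ℕ) (h : Fin N → EuclideanSpace ℝ (Fin (d - 1)) → EuclideanSpace ℝ (Fin d)),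
    (∀ i, ∃ K : NNReal, LipschitzWith K (h i)) ∧
      Measure.hausdorffMeasure ((d - 1 : ℕ) : ℝ) (frontier Ω \ ⋃ i, range (h i)) = 0
  minkowski : ∃ C : ℝ, ∀ r ∈ Ioc (0 : ℝ) 1,
    volume (Metric.cthickening r (frontier Ω)) ≤ ENNReal.ofReal (C * r)

/-- The closed `r`-neighbourhood of a Lipschitz image of a ball of `ℝ^{d-1}` has volume `O(r)`. -/
lemma volume_lipschitz_tube_le {n d : ℕ} (hnd : d = n + 1)
    {h : EuclideanSpace ℝ (Fin n) → EuclideanSpace ℝ (Fin d)} {K : NNReal} (hK : LipschitzWith K h)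
    (R : ℝ) : ∃ C : ℝ, 0 ≤ C ∧ ∀ r ∈ Ioc (0 : ℝ) 1,
      volume (⋃ u ∈ Metric.closedBall 0 R, Metric.closedBall (h u) r) ≤ ENNReal.ofReal (C * r) := by
  set cn : ENNReal := volume (Metric.ball (0 : EuclideanSpace ℝ (Fin n)) 1) with hcn
  set cd : ENNReal := volume (Metric.ball (0 : EuclideanSpace ℝ (Fin d)) 1) with hcd
  set B : ENNReal := volume (Metric.closedBall (0 : EuclideanSpace ℝ (Fin n)) (R + 1)) with hB
  have hcn0 : cn ≠ 0 := (Metric.measure_ball_pos _ _ one_pos).ne'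
  have hcnt : cn ≠ ⊤ := measure_ball_lt_top.ne
  have hcdt : cd ≠ ⊤ := measure_ball_lt_top.ne
  have hBt : B ≠ ⊤ := measure_closedBall_lt_top.ne
  refine ⟨(B * (ENNReal.ofReal ((K + 1) ^ d) * cd) / cn).toReal, ENNReal.toReal_nonneg, ?_⟩
  rintro r ⟨hr0, hr1⟩
  set V := ⋃ u ∈ Metric.closedBall 0 R, Metric.closedBall (h u) r with hV
  set s : ℝ := (K + 1) * r with hs
  have hs0 : 0 ≤ s := by positivity
  let W : Set (EuclideanSpace ℝ (Fin n) × EuclideanSpace ℝ (Fin d)) :=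
    {p | p.1 ∈ Metric.closedBall 0 (R + 1) ∧ dist p.2 (h p.1) ≤ s}
  have hW : MeasurableSet W := by
    refine IsClosed.measurableSet ?_
    have := hK.continuous
    exact (Metric.isClosed_closedBall.preimage continuous_fst).inter
      (isClosed_le (continuous_snd.dist (this.comp continuous_fst)) continuous_const)
  have h1 : (volume.prod volume) W ≤ B * (ENNReal.ofReal (s ^ d) * cd) := by
    rw [Measure.prod_apply hW]
    calc ∫⁻ u, volume (Prod.mk u ⁻¹' W)
        ≤ ∫⁻ u, (Metric.closedBall (0 : EuclideanSpace ℝ (Fin n)) (R + 1)).indicator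
            (fun _ => ENNReal.ofReal (s ^ d) * cd) u := by
          refine lintegral_mono fun u => ?_
          by_cases hu : u ∈ Metric.closedBall (0 : EuclideanSpace ℝ (Fin n)) (R + 1)
          · rw [indicator_of_mem hu]
            have : Prod.mk u ⁻¹' W ⊆ Metric.closedBall (h u) s := fun z hz => hz.2
            refine (measure_mono this).trans ?_
            rw [Measure.addHaar_closedBall _ _ hs0]
            simp [hcd]
          · have : Prod.mk u ⁻¹' W = ∅ := by
              ext z; simp only [mem_preimage, mem_empty_iff_false, iff_false]
              exact fun hz => hu hz.1
            simp [this]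
      _ = B * (ENNReal.ofReal (s ^ d) * cd) := by
          rw [lintegral_indicator Metric.isClosed_closedBall.measurableSet, setLIntegral_const,
            mul_comm]
  have h2 : ENNReal.ofReal (r ^ n) * cn * volume V ≤ (volume.prod volume) W := by
    rw [Measure.prod_apply_symm hW]
    have hm : Measurable fun z : EuclideanSpace ℝ (Fin d) =>
        volume ((fun u : EuclideanSpace ℝ (Fin n) => (u, z)) ⁻¹' W) :=
      measurable_measure_prodMk_right hW
    refine le_trans ?_ (mul_meas_ge_le_lintegral hm (ENNReal.ofReal (r ^ n) * cn))
    gcongr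
    intro z hz
    simp only [hV, mem_iUnion] at hz
    obtain ⟨u, hu, hz⟩ := hz
    have : Metric.closedBall u r ⊆ (fun u : EuclideanSpace ℝ (Fin n) => (u, z)) ⁻¹' W := by
      intro w hw
      rw [Metric.mem_closedBall] at hw hz hu
      refine ⟨?_, ?_⟩
      · rw [Metric.mem_closedBall]
        linarith [dist_triangle w u 0]
      · have e1 := dist_triangle z (h u) (h w)
        have e2 := hK.dist_le_mul u w
        rw [dist_comm u w] at e2
        have e3 : (K : ℝ) * dist w u ≤ K * r := by gcongr
        simp only [hs]; linarith
    refine le_trans ?_ (measure_mono this)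
    rw [Measure.addHaar_closedBall _ _ hr0.le]
    simp [hcn]
  have h3 := h2.trans h1
  have hrn : ENNReal.ofReal (r ^ n) ≠ 0 := by simpa using pow_pos hr0 n
  have hfin : B * (ENNReal.ofReal ((K + 1) ^ d) * cd) / cn ≠ ⊤ :=
    ENNReal.div_ne_top (ENNReal.mul_ne_top hBt (ENNReal.mul_ne_top ENNReal.ofReal_ne_top hcdt)) hcn0
  rw [ENNReal.ofReal_mul ENNReal.toReal_nonneg, ENNReal.ofReal_toReal hfin]
  have h4 : ENNReal.ofReal (s ^ d)
      = ENNReal.ofReal ((K + 1) ^ d) * (ENNReal.ofReal (r ^ n) * ENNReal.ofReal r) := by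
    rw [← ENNReal.ofReal_mul (by positivity), ← ENNReal.ofReal_mul (by positivity), hs, mul_pow]
    congr 2
    rw [hnd, pow_succ]
  rw [h4] at h3
  rw [← ENNReal.mul_le_mul_iff_right (a := ENNReal.ofReal (r ^ n) * cn)
    (mul_ne_zero hrn hcn0) (ENNReal.mul_ne_top ENNReal.ofReal_ne_top hcnt)]
  refine h3.trans (le_of_eq ?_)
  have h5 : cn * (B * (ENNReal.ofReal ((K + 1) ^ d) * cd) / cn)
      = B * (ENNReal.ofReal ((K + 1) ^ d) * cd) := ENNReal.mul_div_cancel hcn0 hcnt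
  calc _ = (B * (ENNReal.ofReal ((K + 1) ^ d) * cd)) * ENNReal.ofReal (r ^ n) * ENNReal.ofReal r := by
        ring
    _ = cn * (B * (ENNReal.ofReal ((K + 1) ^ d) * cd) / cn) * ENNReal.ofReal (r ^ n) *
          ENNReal.ofReal r := by rw [h5]
    _ = _ := by
        generalize B * (ENNReal.ofReal ((K + 1) ^ d) * cd) / cn = q
        ring

/-- Every bounded open set whose boundary is covered by finitely many Lipschitz images of bounded
subsets of `ℝ^{d-1}` is a Lipschitz domain. -/
theorem IsLipschitzDomain.of_frontier_subset {d : ℕ} (hd : 1 ≤ d)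
    {Ω : Set (EuclideanSpace ℝ (Fin d))} (ho : IsOpen Ω) (hb : Bornology.IsBounded Ω)
    {N : ℕ} (h : Fin N → EuclideanSpace ℝ (Fin (d - 1)) → EuclideanSpace ℝ (Fin d))
    (hL : ∀ i, ∃ K : NNReal, LipschitzWith K (h i)) (R : ℝ)
    (hcov : frontier Ω ⊆ ⋃ i, h i '' Metric.closedBall 0 R) : IsLipschitzDomain Ω where
  isOpen := ho
  isBounded := hb
  rectifiable := by
    refine ⟨N, h, hL, ?_⟩
    have : frontier Ω ⊆ ⋃ i, range (h i) :=
      hcov.trans (iUnion_mono fun i => image_subset_range _ _)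
    rw [sdiff_eq_empty.mpr this, measure_empty]
  minkowski := by
    have key : ∀ i, ∃ C : ℝ, 0 ≤ C ∧ ∀ r ∈ Ioc (0 : ℝ) 1,
        volume (⋃ u ∈ Metric.closedBall 0 R, Metric.closedBall (h i u) r)
          ≤ ENNReal.ofReal (C * r) := fun i => by
      obtain ⟨K, hK⟩ := hL i
      exact volume_lipschitz_tube_le (by omega) hK R
    choose C hC0 hC using key
    refine ⟨∑ i, C i, fun r hr => ?_⟩
    have hcpt : IsCompact (frontier Ω) :=
      Metric.isCompact_of_isClosed_isBounded isClosed_frontier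
        (hb.closure.subset frontier_subset_closure)
    rw [hcpt.cthickening_eq_biUnion_closedBall hr.1.le]
    have hsub : ⋃ x ∈ frontier Ω, Metric.closedBall x r ⊆
        ⋃ i, ⋃ u ∈ Metric.closedBall 0 R, Metric.closedBall (h i u) r := by
      refine iUnion₂_subset fun x hx => ?_
      obtain ⟨i, u, hu, rfl⟩ := mem_iUnion.mp (hcov hx)
      exact subset_iUnion_of_subset i (subset_iUnion₂_of_subset u hu subset_rfl)
    refine (measure_mono hsub).trans ((measure_iUnion_fintype_le _ _).trans ?_)
    rw [Finset.sum_mul, ENNReal.ofReal_sum_of_nonneg fun i _ => mul_nonneg (hC0 i) hr.1.le]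
    exact Finset.sum_le_sum fun i _ => hC i r hr

/-- The ring of sets generated by the Lipschitz domains and all subsets of their boundaries. -/
def lipschitzRing (d : ℕ) : Set (Set (EuclideanSpace ℝ (Fin d))) :=
  {A | ∀ C : Set (Set (EuclideanSpace ℝ (Fin d))), IsSetRing C →
    (∀ Ω, IsLipschitzDomain Ω → Ω ∈ C ∧ ∀ N, N ⊆ frontier Ω → N ∈ C) → A ∈ C}

/-! ## Self-similar tile-substitutions -/

/-- A translate `A j + x` of a prototile of type `j`, recorded as the pair `(j, x)`. Since the
prototiles below have nonempty bounded supports, a translate determines its pair `(j, x)`. -/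
abbrev Tile (d m : ℕ) : Type := Fin m × EuclideanSpace ℝ (Fin d)

/-- The translate `T - y` of a set of tiles. -/
def translateTiles {d m : ℕ} (T : Set (Tile d m)) (y : EuclideanSpace ℝ (Fin d)) :
    Set (Tile d m) :=
  (fun t : Tile d m => (t.1, t.2 - y)) '' T

/-- A tile-substitution in `ℝ^d` with `m` prototiles whose expansion `φ` is a similitude with
dilatation `lam > 1`. The patch `ω(T_j)` is `sub j`. -/
structure TileSubstitution (d m : ℕ) where
  /-- supports of the prototiles -/
  A : Fin m → Set (EuclideanSpace ℝ (Fin d))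
  isCompact_A : ∀ j, IsCompact (A j)
  nonempty_A : ∀ j, (A j).Nonempty
  closure_interior_A : ∀ j, closure (interior (A j)) = A j
  /-- the expansion map -/
  φ : EuclideanSpace ℝ (Fin d) ≃ₗ[ℝ] EuclideanSpace ℝ (Fin d)
  /-- the linear dilatation -/
  lam : ℝ
  one_lt_lam : 1 < lam
  norm_φ : ∀ x, ‖φ x‖ = lam * ‖x‖
  /-- the patch `ω(T_j)` -/
  sub : Fin m → Finset (Tile d m)
  disjoint_sub : ∀ j, (sub j : Set (Tile d m)).Pairwise fun s t =>
    Disjoint (interior ((fun a => a + s.2) '' A s.1)) (interior ((fun a => a + t.2) '' A t.1))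
  supp_sub : ∀ j, ⋃ t ∈ sub j, (fun a => a + t.2) '' A t.1 = φ '' A j

namespace TileSubstitution

variable {d m : ℕ} (σ : TileSubstitution d m)

/-- The support of a tile. -/
def supp (t : Tile d m) : Set (EuclideanSpace ℝ (Fin d)) :=
  (fun a => a + t.2) '' σ.A t.1

/-- The action of the substitution on sets of tiles, `ω(T_j + x) = ω(T_j) + φ x`. -/
def inflate (T : Set (Tile d m)) : Set (Tile d m) :=
  {p | ∃ t ∈ T, ∃ s ∈ σ.sub t.1, p = (s.1, s.2 + σ.φ t.2)}

/-- The patch `ω^n(T_j)`. -/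
def iteratePatch (n : ℕ) (j : Fin m) : Set (Tile d m) :=
  σ.inflate^[n] {((j, 0) : Tile d m)}

/-- Tilings of `ℝ^d` by translates of the prototiles. -/
def IsTiling (T : Set (Tile d m)) : Prop :=
  ⋃ t ∈ T, σ.supp t = univ ∧
    T.Pairwise fun s t => Disjoint (interior (σ.supp s)) (interior (σ.supp t))

/-- The tiling space `X_ω`: every finite patch of the tiling is a translate of a subpatch of
some `ω^n(T_j)`. -/
def tilingSpace : Set (Set (Tile d m)) :=
  {T | σ.IsTiling T ∧ ∀ P ⊆ T, P.Finite →
    ∃ (n : ℕ) (j : Fin m) (y : EuclideanSpace ℝ (Fin d)),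
      translateTiles P y ⊆ σ.iteratePatch n j}

/-- The substitution matrix: `S i j` is the number of tiles of type `i` in `ω(T_j)`. -/
def substMatrix : Matrix (Fin m) (Fin m) ℕ :=
  fun i j => ((σ.sub j).filter fun t => t.1 = i).card

/-- Some positive power of the substitution matrix has only positive entries. -/
def IsPrimitive : Prop :=
  ∃ k : ℕ, 0 < k ∧ ∀ i j, 0 < (σ.substMatrix ^ k) i j

/-- Finite local complexity: up to translation there are finitely many subpatches of the
`ω^n(T_j)` of diameter less than a given `R`. -/
def HasFLC : Prop :=
  ∀ R : ℝ, 0 < R → ∃ F : Set (Set (Tile d m)), F.Finite ∧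
    ∀ (n : ℕ) (j : Fin m), ∀ P ⊆ σ.iteratePatch n j,
      Metric.diam (⋃ t ∈ P, σ.supp t) < R →
        ∃ y : EuclideanSpace ℝ (Fin d), translateTiles P y ∈ F

/-- No tiling of the tiling space has a nonzero period. -/
def IsNonPeriodic : Prop :=
  ∀ T ∈ σ.tilingSpace, ∀ y : EuclideanSpace ℝ (Fin d), translateTiles T y = T → y = 0

/-! ## Tiles of all orders -/

open Classical in
/-- The tiling `φ^{-k} T^{(k)}`, where `T^{(k)}` is the tiling of order `k` associated with `T`.
For `k ≤ 0` it is `ω^{|k|}(T)` (subdivide `|k|` times). For `k > 0` it is the tiling `R` in the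
tiling space with `ω^k(R) = T`; for non-periodic `ω` there is exactly one such `R`. -/
def level (T : Set (Tile d m)) (k : ℤ) : Set (Tile d m) :=
  if k ≤ 0 then σ.inflate^[k.natAbs] T
  else if h : ∃ R ∈ σ.tilingSpace, σ.inflate^[k.natAbs] R = T then h.choose else ∅

/-- The support `φ^k (supp t)` of the tile `φ^k t` of order `k`. -/
def orderSupp (k : ℤ) (t : Tile d m) : Set (EuclideanSpace ℝ (Fin d)) :=
  (σ.φ ^ k) '' σ.supp t

/-- `∂T^{(k)}`, the union of the boundaries of the tiles of order `k`. -/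
def levelBoundary (T : Set (Tile d m)) (k : ℤ) : Set (EuclideanSpace ℝ (Fin d)) :=
  ⋃ t ∈ σ.level T k, frontier (σ.orderSupp k t)

/-- The support of `T^{(k)}|_Ω`, the collection of tiles of order `k` contained in `Ω`. -/
def packing (T : Set (Tile d m)) (Ω : Set (EuclideanSpace ℝ (Fin d))) (k : ℤ) :
    Set (EuclideanSpace ℝ (Fin d)) :=
  ⋃ t ∈ {t ∈ σ.level T k | σ.orderSupp k t ⊆ Ω}, σ.orderSupp k t

/-- The ring `𝒞⁺_T` of all sets `(supp P \ N₁) ∪ N₂`, where `P` is a (finite) patch of tiles of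
`T^{(k)}` and `N₁, N₂ ⊆ ∂T^{(k)}`, for some integer `k`. -/
def tileRing (T : Set (Tile d m)) : Set (Set (EuclideanSpace ℝ (Fin d))) :=
  {F | ∃ (k : ℤ) (P : Set (Tile d m)) (N₁ N₂ : Set (EuclideanSpace ℝ (Fin d))),
    P ⊆ σ.level T k ∧ P.Finite ∧ N₁ ⊆ σ.levelBoundary T k ∧ N₂ ⊆ σ.levelBoundary T k ∧
      F = ((⋃ t ∈ P, σ.orderSupp k t) \ N₁) ∪ N₂}

/-! ## The rapidly expanding subspace -/

/-- The transpose `Sᵗ` of the substitution matrix, acting on `ℂ^m`. -/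
def transposeMap : Module.End ℂ (Fin m → ℂ) :=
  Matrix.toLin' (σ.substMatrix.map (Nat.cast : ℕ → ℂ)).transpose

/-- The rapidly expanding subspace `E⁺⁺`: the span of the generalized eigenspaces of `Sᵗ` for
the eigenvalues `θ` with `|θ| > lam^{d-1}`. -/
def rapidlyExpanding : Submodule ℂ (Fin m → ℂ) :=
  ⨆ θ ∈ {θ : ℂ | σ.lam ^ (d - 1) < ‖θ‖}, σ.transposeMap.maxGenEigenspace θ

lemma transposeMap_mem {v : Fin m → ℂ} (hv : v ∈ σ.rapidlyExpanding) :
    σ.transposeMap v ∈ σ.rapidlyExpanding := by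
  have h : σ.rapidlyExpanding ≤ σ.rapidlyExpanding.comap σ.transposeMap := by
    refine iSup₂_le fun θ hθ w hw => ?_
    exact (le_iSup₂ (f := fun (θ : ℂ) (_ : θ ∈ {θ : ℂ | σ.lam ^ (d - 1) < ‖θ‖}) =>
      σ.transposeMap.maxGenEigenspace θ) θ hθ)
      (Module.End.mapsTo_maxGenEigenspace_of_comm (Commute.refl _) θ hw)
  exact h hv

lemma transposeMap_restrict_injective :
    Function.Injective
      (σ.transposeMap.restrict (p := σ.rapidlyExpanding) fun _ => σ.transposeMap_mem) := by
  rw [← LinearMap.ker_eq_bot, LinearMap.ker_eq_bot']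
  rintro ⟨v, hv⟩ h
  have h0 : σ.transposeMap v = 0 := congrArg Subtype.val h
  have hker : v ∈ σ.transposeMap.maxGenEigenspace 0 := by
    rw [Module.End.mem_maxGenEigenspace]
    exact ⟨1, by simpa using h0⟩
  have hnot : (0 : ℂ) ∉ {θ : ℂ | σ.lam ^ (d - 1) < ‖θ‖} := by
    have : 0 < σ.lam ^ (d - 1) := pow_pos (zero_lt_one.trans σ.one_lt_lam) _
    simpa using this.le
  have hd := (σ.transposeMap.independent_maxGenEigenspace).disjoint_biSup hnot
  exact Subtype.ext (Submodule.disjoint_def.mp hd v hker hv)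

/-- `Sᵗ` as an automorphism of `E⁺⁺`, so that `(Sᵗ)^k v` makes sense for all integers `k`. -/
def transposeEquiv : σ.rapidlyExpanding ≃ₗ[ℂ] σ.rapidlyExpanding :=
  LinearEquiv.ofInjectiveEndo
    (σ.transposeMap.restrict (p := σ.rapidlyExpanding) fun _ => σ.transposeMap_mem)
    σ.transposeMap_restrict_injective

lemma transposeEquiv_apply (v : σ.rapidlyExpanding) :
    (σ.transposeEquiv v : Fin m → ℂ) = σ.transposeMap v := rfl

end TileSubstitution

end

/-! ## Finitely-additive measures from nested families of cells -/

/-! Give each tile of order -n and type j the weight ((Sᵗ)^{-n} v)_j. Since (Sᵗx)_j is the sum of x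
over the types of the tiles of ω(T_j), the weight of a tile is the total weight of its subdivision.
The measure of F is then the limit over n of the total weight of the tiles of order -n whose
interiors lie in F (`tileMeasure`). Passing from n to n + 1 changes this sum only through the pieces
of the tiles that F cuts (`norm_cellSum_succ_sub_le`), so the sums converge as soon as the number of
cut tiles times ‖(Sᵗ)^{-n-1} v‖ is summable. The sets with this property form a ring, and the limit
is additive on it: a cell inside F ∪ G but inside neither is a cut cell, and the weight of the cut
cells tends to 0 (`limUnder_cellSum_union`).

Two estimates place the Lipschitz ring inside this ring. Comparing volumes near the boundary, F cuts
O(λ^{n(d-1)}) tiles of order -n (`exists_ncard_cut_le`). The eigenvalues of Sᵗ on E⁺⁺ exceed λ^{d-1}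
in modulus, so Gelfand's formula makes λ^{n(d-1)} ‖(Sᵗ)^{-n} v‖ decay geometrically
(`summable_pow_mul_norm_inv_pow`). A set of the tile ring cuts no tile from some order on, so its
sums are eventually constant (`tileMeasure_patch`).

Thus Ψ and Φ⁺ are restrictions of one set function and agree where both are defined. The cocycle
relations only reindex the sums: translation moves the cells, and inflation drops the first level of
the hierarchy. -/

/-- Families `L n` of indices of pairwise disjoint nonempty cells, each family refining the
previous one: the cells of `L (n + 1)` are the children of those of `L n`. -/
structure IsCellHierarchy {X ι : Type*} (L : ℕ → Set ι) (cell : ℕ → ι → Set X)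
    (ch : ι → Finset ι) : Prop where
  cell_nonempty : ∀ n, ∀ t ∈ L n, (cell n t).Nonempty
  pairwiseDisjoint : ∀ n, (L n).PairwiseDisjoint (cell n)
  mem_of_mem_children : ∀ n, ∀ t ∈ L n, ∀ s ∈ ch t, s ∈ L (n + 1)
  exists_parent : ∀ n, ∀ s ∈ L (n + 1), ∃ t ∈ L n, s ∈ ch t
  cell_subset : ∀ n, ∀ t ∈ L n, ∀ s ∈ ch t, cell (n + 1) s ⊆ cell n t

/-- The weight of a cell is the sum of the weights of its children, `W n` bounds the weights of
the cells of `L n`, and `M` bounds the numbers of children. -/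
structure IsCellWeight {ι : Type*} (ch : ι → Finset ι) (w : ℕ → ι → ℂ) (W : ℕ → ℝ) (M : ℝ) :
    Prop where
  eq_sum : ∀ n t, w n t = ∑ s ∈ ch t, w (n + 1) s
  norm_le : ∀ n t, ‖w n t‖ ≤ W n
  card_le : ∀ t, ((ch t).card : ℝ) ≤ M
  bound_le : ∀ n, W n ≤ M * W (n + 1)
  bound_nonneg : ∀ n, 0 ≤ W n

/-- The cells of `L n` contained in `F`. -/
def innerCells {X ι : Type*} (L : ℕ → Set ι) (cell : ℕ → ι → Set X) (n : ℕ) (F : Set X) : Set ι :=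
  {t ∈ L n | cell n t ⊆ F}

/-- The cells of `L n` that meet both `F` and its complement. -/
def cutCells {X ι : Type*} (L : ℕ → Set ι) (cell : ℕ → ι → Set X) (n : ℕ) (F : Set X) : Set ι :=
  {t ∈ L n | ¬ cell n t ⊆ F ∧ ¬ Disjoint (cell n t) F}

/-- The total weight of the cells of `L n` contained in `F`. -/
noncomputable def cellSum {X ι : Type*} (L : ℕ → Set ι) (cell : ℕ → ι → Set X) (w : ℕ → ι → ℂ)
    (n : ℕ) (F : Set X) : ℂ :=
  ∑ᶠ t ∈ innerCells L cell n F, w n t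

/-- The sets which from some `n` on meet finitely many cells of `L n`, and for which the total
weight of the cells that they cut is summable over `n`. -/
def negligibleCut {X ι : Type*} (L : ℕ → Set ι) (cell : ℕ → ι → Set X) (W : ℕ → ℝ) :
    Set (Set X) :=
  {F | (∀ᶠ n in atTop, (innerCells L cell n F).Finite ∧ (cutCells L cell n F).Finite) ∧
    Summable fun n => ((cutCells L cell n F).ncard : ℝ) * W (n + 1)}

namespace IsCellHierarchy

variable {X ι : Type*} {L : ℕ → Set ι} {cell : ℕ → ι → Set X} {ch : ι → Finset ι}
  {w : ℕ → ι → ℂ} {W : ℕ → ℝ} {M : ℝ} {F G : Set X} {n : ℕ}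

lemma eq_parent (h : IsCellHierarchy L cell ch) {t t' s : ι} (ht : t ∈ L n) (ht' : t' ∈ L n)
    (hs : s ∈ ch t) (hs' : s ∈ ch t') : t = t' := by
  by_contra hne
  obtain ⟨x, hx⟩ := h.cell_nonempty (n + 1) s (h.mem_of_mem_children n t ht s hs)
  exact (h.pairwiseDisjoint n ht ht' hne).le_bot
    ⟨h.cell_subset n t ht s hs hx, h.cell_subset n t' ht' s hs' hx⟩

lemma innerCells_disjoint (h : IsCellHierarchy L cell ch) (hFG : Disjoint F G) :
    Disjoint (innerCells L cell n F) (innerCells L cell n G) := by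
  rw [Set.disjoint_left]
  rintro t ⟨ht, hF⟩ ⟨-, hG⟩
  obtain ⟨x, hx⟩ := h.cell_nonempty n t ht
  exact hFG.le_bot ⟨hF hx, hG hx⟩

/-- A child of a cell that meets `F` is a child of an inner cell or of a cut cell. -/
lemma exists_parent_mem (h : IsCellHierarchy L cell ch) {s : ι} (hs : s ∈ L (n + 1))
    (hF : ¬ Disjoint (cell (n + 1) s) F) :
    ∃ t ∈ innerCells L cell n F ∪ cutCells L cell n F, s ∈ ch t := by
  obtain ⟨t, ht, hst⟩ := h.exists_parent n s hs
  refine ⟨t, ?_, hst⟩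
  by_cases hc : cell n t ⊆ F
  · exact Or.inl ⟨ht, hc⟩
  · exact Or.inr ⟨ht, hc, fun hd => hF (hd.mono_left (h.cell_subset n t ht s hst))⟩

lemma not_disjoint_of_mem_innerCells (h : IsCellHierarchy L cell ch) {t : ι}
    (ht : t ∈ innerCells L cell n F) : ¬ Disjoint (cell n t) F := by
  obtain ⟨x, hx⟩ := h.cell_nonempty n t ht.1
  exact fun hd => hd.le_bot ⟨hx, ht.2 hx⟩

/-- Each cell is inside F, cut by F, or disjoint from F. The children of the first kind all survive,
those of the second in part, those of the third not at all. -/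
lemma innerCells_succ (h : IsCellHierarchy L cell ch) :
    innerCells L cell (n + 1) F = (⋃ t ∈ innerCells L cell n F, (ch t : Set ι)) ∪
      ⋃ t ∈ cutCells L cell n F, {s | s ∈ ch t ∧ cell (n + 1) s ⊆ F} := by
  ext s
  simp only [mem_union, mem_iUnion, exists_prop, mem_ofPred_eq, Finset.mem_coe]
  constructor
  · intro hs
    obtain ⟨t, ht | ht, hst⟩ := h.exists_parent_mem hs.1 (h.not_disjoint_of_mem_innerCells hs)
    · exact Or.inl ⟨t, ht, hst⟩
    · exact Or.inr ⟨t, ht, hst, hs.2⟩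
  · rintro (⟨t, ht, hst⟩ | ⟨t, ht, hst, hs⟩)
    · exact ⟨h.mem_of_mem_children n t ht.1 s hst, (h.cell_subset n t ht.1 s hst).trans ht.2⟩
    · exact ⟨h.mem_of_mem_children n t ht.1 s hst, hs⟩

lemma cutCells_succ_subset (h : IsCellHierarchy L cell ch) :
    cutCells L cell (n + 1) F ⊆ ⋃ t ∈ cutCells L cell n F, (ch t : Set ι) := by
  intro s hs
  obtain ⟨t, ht | ht, hst⟩ := h.exists_parent_mem hs.1 hs.2.2
  · exact absurd ((h.cell_subset n t ht.1 s hst).trans ht.2) hs.2.1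
  · exact mem_biUnion ht hst

lemma finite_succ (h : IsCellHierarchy L cell ch) (hi : (innerCells L cell n F).Finite)
    (hc : (cutCells L cell n F).Finite) :
    (innerCells L cell (n + 1) F).Finite ∧ (cutCells L cell (n + 1) F).Finite := by
  refine ⟨?_, (hc.biUnion fun t _ => (ch t).finite_toSet).subset h.cutCells_succ_subset⟩
  rw [h.innerCells_succ]
  exact (hi.biUnion fun t _ => (ch t).finite_toSet).union
    (hc.biUnion fun t _ => (ch t).finite_toSet.subset fun s hs => hs.1)

lemma norm_finsum_le (hw : IsCellWeight ch w W M) {Q : Set ι} (hQ : Q.Finite) :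
    ‖∑ᶠ t ∈ Q, w n t‖ ≤ Q.ncard * W n := by
  rw [finsum_mem_eq_finite_toFinset_sum _ hQ, Set.ncard_eq_toFinset_card _ hQ]
  exact (norm_sum_le_of_le _ fun t _ => hw.norm_le n t).trans (by simp)

/-- Subdividing an inner cell preserves its weight, so the two sums differ only by those children of
cut cells that fall inside F. There are at most `M` of them per cut cell, each of weight at most `W
(n + 1)`. -/
lemma norm_cellSum_succ_sub_le (h : IsCellHierarchy L cell ch) (hw : IsCellWeight ch w W M)
    (hi : (innerCells L cell n F).Finite) (hc : (cutCells L cell n F).Finite) :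
    ‖cellSum L cell w (n + 1) F - cellSum L cell w n F‖
      ≤ M * ((cutCells L cell n F).ncard * W (n + 1)) := by
  classical
  have hmem : ∀ {t}, t ∈ innerCells L cell n F ∪ cutCells L cell n F → t ∈ L n := by
    rintro t (ht | ht) <;> exact ht.1
  have hdis : (innerCells L cell n F ∪ cutCells L cell n F).PairwiseDisjoint
      fun t => (ch t : Set ι) := fun t ht t' ht' hne =>
    Set.disjoint_left.mpr fun s hs hs' => hne (h.eq_parent (hmem ht) (hmem ht') hs hs')
  have hsum : cellSum L cell w (n + 1) F = cellSum L cell w n F +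
      ∑ᶠ t ∈ cutCells L cell n F, ∑ᶠ s ∈ {s | s ∈ ch t ∧ cell (n + 1) s ⊆ F}, w (n + 1) s := by
    have hfin : ∀ t, {s | s ∈ ch t ∧ cell (n + 1) s ⊆ F}.Finite := fun t =>
      (ch t).finite_toSet.subset fun s hs => hs.1
    rw [cellSum, h.innerCells_succ, finsum_mem_union ?_ ?_ ?_, finsum_mem_biUnion ?_ hi ?_,
      finsum_mem_biUnion ?_ hc ?_]
    · congr 1
      rw [cellSum]
      refine finsum_mem_congr rfl fun t _ => ?_
      rw [hw.eq_sum, finsum_mem_coe_finset]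
    · exact fun t ht t' ht' hne =>
        (hdis (Or.inr ht) (Or.inr ht') hne).mono (fun s hs => hs.1) (fun s hs => hs.1)
    · exact fun t _ => hfin t
    · exact hdis.subset subset_union_left
    · exact fun t _ => (ch t).finite_toSet
    · rw [Set.disjoint_left]
      intro s hs hs'
      simp only [mem_iUnion, exists_prop] at hs hs'
      obtain ⟨t, ht, hst⟩ := hs
      obtain ⟨t', ht', hst', -⟩ := hs'
      obtain rfl := h.eq_parent ht.1 ht'.1 hst hst'
      exact ht'.2.1 ht.2
    · exact hi.biUnion fun t _ => (ch t).finite_toSet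
    · exact hc.biUnion fun t _ => hfin t
  rw [hsum, add_sub_cancel_left, finsum_mem_eq_finite_toFinset_sum _ hc,
    Set.ncard_eq_toFinset_card _ hc]
  refine (norm_sum_le_of_le (f := fun t => ∑ᶠ s ∈ {s | s ∈ ch t ∧ cell (n + 1) s ⊆ F}, w (n + 1) s)
    (n := fun _ => M * W (n + 1)) _ fun t _ => ?_).trans (by simp; linarith)
  refine (norm_finsum_le hw ((ch t).finite_toSet.subset fun s hs => hs.1)).trans ?_
  refine mul_le_mul_of_nonneg_right ((Nat.cast_le.mpr ?_).trans (hw.card_le t))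
    (hw.bound_nonneg _)
  exact (Set.ncard_le_ncard (fun s hs => hs.1) (ch t).finite_toSet).trans
    (Set.ncard_coe_finset _).le

/-- The total weights of the inner cells of a set with negligible cut converge. -/
lemma exists_tendsto_cellSum (h : IsCellHierarchy L cell ch) (hw : IsCellWeight ch w W M)
    (hF : F ∈ negligibleCut L cell W) :
    ∃ z, Tendsto (fun n => cellSum L cell w n F) atTop (𝓝 z) := by
  obtain ⟨N, hN⟩ := eventually_atTop.mp hF.1
  have hs : Summable fun n =>
      M * (((cutCells L cell (n + N) F).ncard : ℝ) * W (n + N + 1)) :=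
    ((summable_nat_add_iff N).mpr hF.2).mul_left M
  have hc : CauchySeq fun n => cellSum L cell w (n + N) F := by
    refine cauchySeq_of_dist_le_of_summable _ (fun n => ?_) hs
    obtain ⟨h1, h2⟩ := hN (n + N) (by omega)
    rw [dist_comm, dist_eq_norm, show n.succ + N = n + N + 1 by omega]
    exact h.norm_cellSum_succ_sub_le hw h1 h2
  obtain ⟨z, hz⟩ := cauchySeq_tendsto_of_complete hc
  exact ⟨z, (tendsto_add_atTop_iff_nat N).mp hz⟩

lemma tendsto_cellSum (h : IsCellHierarchy L cell ch) (hw : IsCellWeight ch w W M)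
    (hF : F ∈ negligibleCut L cell W) :
    Tendsto (fun n => cellSum L cell w n F) atTop
      (𝓝 (limUnder atTop fun n => cellSum L cell w n F)) :=
  tendsto_nhds_limUnder (h.exists_tendsto_cellSum hw hF)

/-- A set that cuts no cell of `L n` cuts no cell of `L k` for `k ≥ n`. -/
lemma resolved_of_le (h : IsCellHierarchy L cell ch) (hi : (innerCells L cell n F).Finite)
    (hc : cutCells L cell n F = ∅) {k : ℕ} (hk : n ≤ k) :
    (innerCells L cell k F).Finite ∧ cutCells L cell k F = ∅ := by
  induction k, hk using Nat.le_induction with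
  | base => exact ⟨hi, hc⟩
  | succ k _ ih =>
    refine ⟨(h.finite_succ ih.1 (by simp [ih.2])).1, ?_⟩
    have := h.cutCells_succ_subset (n := k) (F := F)
    simpa [ih.2] using this

lemma mem_negligibleCut_of_resolved (h : IsCellHierarchy L cell ch)
    (hi : (innerCells L cell n F).Finite) (hc : cutCells L cell n F = ∅) :
    F ∈ negligibleCut L cell W := by
  refine ⟨?_, ?_⟩
  · filter_upwards [eventually_ge_atTop n] with k hk
    obtain ⟨h1, h2⟩ := h.resolved_of_le hi hc hk
    exact ⟨h1, by simp [h2]⟩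
  · refine (summable_nat_add_iff n).mp (summable_zero.congr fun k => ?_)
    simp [(h.resolved_of_le hi hc (Nat.le_add_left n k)).2]

lemma limUnder_cellSum_of_resolved (h : IsCellHierarchy L cell ch) (hw : IsCellWeight ch w W M)
    (hi : (innerCells L cell n F).Finite) (hc : cutCells L cell n F = ∅) :
    limUnder atTop (fun n => cellSum L cell w n F) = cellSum L cell w n F := by
  refine Tendsto.limUnder_eq (tendsto_atTop_of_eventually_const (i₀ := n) fun k hk => ?_)
  induction k, hk using Nat.le_induction with
  | base => rfl
  | succ k hk ih =>
    obtain ⟨h1, h2⟩ := h.resolved_of_le hi hc hk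
    have := h.norm_cellSum_succ_sub_le hw h1 (by simp [h2])
    rw [h2, ih] at this
    simpa [sub_eq_zero] using this

lemma cutCells_union_subset :
    cutCells L cell n (F ∪ G) ⊆ cutCells L cell n F ∪ cutCells L cell n G := by
  rintro t ⟨ht, h1, h2⟩
  rw [disjoint_union_right, not_and_or] at h2
  rcases h2 with h2 | h2
  · exact Or.inl ⟨ht, fun hs => h1 (hs.trans subset_union_left), h2⟩
  · exact Or.inr ⟨ht, fun hs => h1 (hs.trans subset_union_right), h2⟩

lemma cutCells_sdiff_subset :
    cutCells L cell n (F \ G) ⊆ cutCells L cell n F ∪ cutCells L cell n G := by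
  rintro t ⟨ht, h1, h2⟩
  obtain ⟨x, hx, hxF, hxG⟩ := Set.not_disjoint_iff.mp h2
  by_cases hF : cell n t ⊆ F
  · refine Or.inr ⟨ht, fun hs => hxG (hs hx), fun hd => h1 fun y hy => ?_⟩
    exact ⟨hF hy, fun hyG => hd.le_bot ⟨hy, hyG⟩⟩
  · exact Or.inl ⟨ht, hF, Set.not_disjoint_iff.mpr ⟨x, hx, hxF⟩⟩

lemma innerCells_union_subset (h : IsCellHierarchy L cell ch) :
    innerCells L cell n (F ∪ G) ⊆ innerCells L cell n F ∪ innerCells L cell n G ∪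
      (cutCells L cell n F ∪ cutCells L cell n G) := by
  rintro t ⟨ht, h1⟩
  obtain ⟨x, hx⟩ := h.cell_nonempty n t ht
  by_cases hF : cell n t ⊆ F
  · exact Or.inl (Or.inl ⟨ht, hF⟩)
  by_cases hG : cell n t ⊆ G
  · exact Or.inl (Or.inr ⟨ht, hG⟩)
  rcases h1 hx with hxF | hxG
  · exact Or.inr (Or.inl ⟨ht, hF, Set.not_disjoint_iff.mpr ⟨x, hx, hxF⟩⟩)
  · exact Or.inr (Or.inr ⟨ht, hG, Set.not_disjoint_iff.mpr ⟨x, hx, hxG⟩⟩)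

lemma summable_of_cutCells_subset (hW : ∀ n, 0 ≤ W n) {H : Set X}
    (hsub : ∀ n, cutCells L cell n H ⊆ cutCells L cell n F ∪ cutCells L cell n G)
    (hF : F ∈ negligibleCut L cell W) (hG : G ∈ negligibleCut L cell W) :
    Summable fun n => ((cutCells L cell n H).ncard : ℝ) * W (n + 1) := by
  refine Summable.of_norm_bounded_eventually_nat (hF.2.add hG.2) ?_
  -- `ncard` vanishes on infinite sets and is monotone only into finite ones, so the comparison is
  -- made where the cuts of `F` and `G` are finite.
  filter_upwards [hF.1, hG.1] with n h1 h2
  rw [Real.norm_of_nonneg (mul_nonneg (Nat.cast_nonneg _) (hW _)), ← add_mul]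
  refine mul_le_mul_of_nonneg_right ?_ (hW _)
  exact_mod_cast (Set.ncard_le_ncard (hsub n) (h1.2.union h2.2)).trans (Set.ncard_union_le _ _)

lemma isSetRing_negligibleCut (h : IsCellHierarchy L cell ch) (hW : ∀ n, 0 ≤ W n) :
    IsSetRing (negligibleCut L cell W) where
  empty_mem := by
    have hi : innerCells L cell 0 ∅ = ∅ := by
      ext t
      simp only [innerCells, mem_ofPred_eq, mem_empty_iff_false, iff_false, not_and,
        subset_empty_iff]
      exact fun ht => (h.cell_nonempty 0 t ht).ne_empty
    exact h.mem_negligibleCut_of_resolved (n := 0) (by simp [hi]) (by simp [cutCells])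
  union_mem F G hF hG := by
    refine ⟨?_, summable_of_cutCells_subset hW (fun n => cutCells_union_subset) hF hG⟩
    filter_upwards [hF.1, hG.1] with n h1 h2
    exact ⟨((h1.1.union h2.1).union (h1.2.union h2.2)).subset h.innerCells_union_subset,
      (h1.2.union h2.2).subset cutCells_union_subset⟩
  sdiff_mem F G hF hG := by
    refine ⟨?_, summable_of_cutCells_subset hW (fun n => cutCells_sdiff_subset) hF hG⟩
    filter_upwards [hF.1, hG.1] with n h1 h2
    exact ⟨h1.1.subset fun t ht => ⟨ht.1, ht.2.trans sdiff_subset⟩,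
      (h1.2.union h2.2).subset cutCells_sdiff_subset⟩

/-- Summability is imposed with `W (n + 1)`, the weight of the pieces, whereas the additivity error
involves `W n`, the weight of the cut cells themselves. The inequality `W n ≤ M * W (n + 1)` bridges
the two. -/
lemma tendsto_ncard_cutCells_mul (hw : IsCellWeight ch w W M)
    (hF : F ∈ negligibleCut L cell W) :
    Tendsto (fun n => ((cutCells L cell n F).ncard : ℝ) * W n) atTop (𝓝 0) := by
  have h0 := hF.2.tendsto_atTop_zero.const_mul M
  rw [mul_zero] at h0
  refine squeeze_zero (fun n => mul_nonneg (Nat.cast_nonneg _) (hw.bound_nonneg n))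
    (fun n => ?_) h0
  have := mul_le_mul_of_nonneg_left (hw.bound_le n)
    (Nat.cast_nonneg (α := ℝ) (cutCells L cell n F).ncard)
  linarith

/-- At each level the defect of additivity is the weight of the cells contained in `F ∪ G` but in
neither set. All of these are cut cells, and their total weight tends to 0. -/
lemma limUnder_cellSum_union (h : IsCellHierarchy L cell ch) (hw : IsCellWeight ch w W M)
    (hF : F ∈ negligibleCut L cell W) (hG : G ∈ negligibleCut L cell W) (hFG : Disjoint F G) :
    limUnder atTop (fun n => cellSum L cell w n (F ∪ G)) =
      limUnder atTop (fun n => cellSum L cell w n F) +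
        limUnder atTop (fun n => cellSum L cell w n G) := by
  have hU := (h.isSetRing_negligibleCut hw.bound_nonneg).union_mem hF hG
  refine tendsto_nhds_unique (h.tendsto_cellSum hw hU) ?_
  have hlim := (h.tendsto_cellSum hw hF).add (h.tendsto_cellSum hw hG)
  refine tendsto_of_tendsto_of_dist hlim ?_
  have h0 := (tendsto_ncard_cutCells_mul hw hF).add (tendsto_ncard_cutCells_mul hw hG)
  rw [add_zero] at h0
  refine tendsto_of_tendsto_of_tendsto_of_le_of_le' tendsto_const_nhds h0
    (Eventually.of_forall fun n => dist_nonneg) ?_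
  filter_upwards [hF.1, hG.1] with n h1 h2
  set A := innerCells L cell n F ∪ innerCells L cell n G with hA
  have hAU : A ⊆ innerCells L cell n (F ∪ G) := by
    rintro t (ht | ht)
    · exact ⟨ht.1, ht.2.trans subset_union_left⟩
    · exact ⟨ht.1, ht.2.trans subset_union_right⟩
  have hB : innerCells L cell n (F ∪ G) \ A ⊆ cutCells L cell n F ∪ cutCells L cell n G :=
    fun t ht => (h.innerCells_union_subset ht.1).resolve_left ht.2
  have hBfin := (h1.2.union h2.2).subset hB
  have hsum : cellSum L cell w n (F ∪ G) = cellSum L cell w n F + cellSum L cell w n G +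
      ∑ᶠ t ∈ innerCells L cell n (F ∪ G) \ A, w n t := by
    rw [cellSum, cellSum, cellSum, ← finsum_mem_union (h.innerCells_disjoint hFG) h1.1 h2.1,
      ← hA, ← finsum_mem_union disjoint_sdiff_right (h1.1.union h2.1) hBfin,
      union_sdiff_cancel hAU]
  rw [dist_comm, dist_eq_norm, hsum, add_sub_cancel_left, ← add_mul]
  refine (norm_finsum_le hw hBfin).trans (mul_le_mul_of_nonneg_right ?_ (hw.bound_nonneg _))
  exact_mod_cast (Set.ncard_le_ncard hB (h1.2.union h2.2)).trans (Set.ncard_union_le _ _)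

/-- The finitely-additive measure given by a weight on a cell hierarchy, on any collection of sets
with negligible cut. -/
noncomputable def content (h : IsCellHierarchy L cell ch) (hw : IsCellWeight ch w W M)
    {C : Set (Set X)} (hC : C ⊆ negligibleCut L cell W) : AddContent ℂ C where
  toFun F := limUnder atTop fun n => cellSum L cell w n F
  empty' := by
    simpa using h.limUnder_cellSum_union hw
      (h.isSetRing_negligibleCut hw.bound_nonneg).empty_mem
      (h.isSetRing_negligibleCut hw.bound_nonneg).empty_mem (disjoint_empty _)
  -- Additivity is proved in the ring `negligibleCut` and restricted to `C`, so `C` itself need not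
  -- be shown to be a ring.
  sUnion' I hI hd _ := by
    have hR := h.isSetRing_negligibleCut hw.bound_nonneg
    exact addContent_sUnion (m := hR.addContent_of_union
      (fun F => limUnder atTop fun n => cellSum L cell w n F)
      (by simpa using h.limUnder_cellSum_union hw hR.empty_mem hR.empty_mem (disjoint_empty _))
      fun {F G} hF hG hFG => h.limUnder_cellSum_union hw hF hG hFG) (hI.trans hC) hd
      (by
        rw [sUnion_eq_biUnion]
        exact hR.biUnion_mem I fun F hF => hC (hI hF))

end IsCellHierarchy

/-! ## Decay of the negative powers of the substitution on the rapidly expanding subspace -/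

/-- The eigenvalues of the inverse of `e` are the inverses of those of `e`, so its spectral radius
is below `r⁻¹`. By Gelfand's formula the norms of its powers are eventually at most `q ^ n` for some
`q` with `r * q < 1`, and a geometric series dominates. -/
lemma summable_pow_mul_norm_inv_pow {E : Type*} [NormedAddCommGroup E] [NormedSpace ℂ E]
    [FiniteDimensional ℂ E] (e : E ≃ₗ[ℂ] E) {r : ℝ} (hr : 0 < r)
    (he : ∀ (θ : ℂ) (x : E), x ≠ 0 → e x = θ • x → r < ‖θ‖) (v : E) :
    Summable fun n : ℕ => r ^ n * ‖(e ^ (-(n : ℤ))) v‖ := by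
  -- The strict bound on the spectral radius below needs a nonempty spectrum, hence a nonzero space.
  rcases subsingleton_or_nontrivial E with hE | hE
  · simp [Subsingleton.elim _ (0 : E)]
  have : CompleteSpace E := FiniteDimensional.complete ℂ E
  let A : E →L[ℂ] E := Module.End.toContinuousLinearMap E e.symm.toLinearMap
  have hA : ∀ x, A x = e.symm x := fun x => rfl
  have hApow : ∀ (n : ℕ) x, (A ^ n) x = (e ^ (-(n : ℤ))) x := by
    intro n
    induction n with
    | zero => simp
    | succ n ih =>
      intro x
      rw [pow_succ, mul_apply_eq_comp, ih, hA,
        show -((n + 1 : ℕ) : ℤ) = -(n : ℤ) + -1 by push_cast; ring, zpow_add, zpow_neg_one]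
      rfl
  have hspec : ∀ z ∈ spectrum ℂ A, ‖z‖₊ < Real.toNNReal r⁻¹ := by
    intro z hz
    rw [AlgEquiv.spectrum_eq, ← Module.End.hasEigenvalue_iff_mem_spectrum] at hz
    obtain ⟨x, hx⟩ := hz.exists_hasEigenvector
    have hzx : e.symm x = z • x := hx.apply_eq_smul
    have hz0 : z ≠ 0 := by
      rintro rfl
      rw [zero_smul, LinearEquiv.map_eq_zero_iff] at hzx
      exact hx.2 hzx
    have hex : e x = z⁻¹ • x := by
      have := congrArg e hzx
      rw [e.apply_symm_apply, map_smul] at this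
      rw [eq_inv_smul_iff₀ hz0, ← this]
    have := he _ _ hx.2 hex
    rw [norm_inv] at this
    rw [← NNReal.coe_lt_coe, coe_nnnorm, Real.coe_toNNReal _ (inv_pos.mpr hr).le]
    exact (lt_inv_comm₀ hr (norm_pos_iff.mpr hz0)).mp this
  have hrad := spectrum.spectralRadius_lt_of_forall_lt A hspec
  obtain ⟨q, hq1, hq2⟩ := ENNReal.lt_iff_exists_nnreal_btwn.mp hrad
  have hq : r * q < 1 := by
    have h : (q : ℝ) < r⁻¹ := by
      rw [← Real.coe_toNNReal _ (inv_pos.mpr hr).le]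
      exact_mod_cast hq2
    rwa [inv_eq_one_div, lt_div_iff₀' hr] at h
  have hev : ∀ᶠ n : ℕ in atTop, ‖A ^ n‖ ≤ (q : ℝ) ^ n := by
    filter_upwards [(spectrum.pow_nnnorm_pow_one_div_tendsto_nhds_spectralRadius A).eventually_lt_const
      hq1, eventually_gt_atTop 0] with n hn hn0
    have hn1 : (0 : ℝ) < n := Nat.cast_pos.mpr hn0
    rw [one_div, ENNReal.rpow_inv_lt_iff hn1, ENNReal.rpow_natCast] at hn
    exact_mod_cast hn.le
  refine Summable.of_norm_bounded_eventually_nat (g := fun n : ℕ => (r * q) ^ n * ‖v‖)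
    ((summable_geometric_of_lt_one (by positivity) hq).mul_right _) ?_
  filter_upwards [hev] with n hn
  rw [Real.norm_of_nonneg (by positivity), ← hApow, mul_pow, mul_assoc]
  gcongr
  exact ((A ^ n).le_opNorm v).trans (by gcongr)

namespace TileSubstitution

variable {d m : ℕ} (σ : TileSubstitution d m)

/-- Generalized eigenspaces are independent, so an eigenvector lying in the span of those for large
eigenvalues must itself have a large eigenvalue. -/
lemma lt_norm_of_transposeEquiv_eq_smul {θ : ℂ} {x : σ.rapidlyExpanding} (hx : x ≠ 0)
    (h : σ.transposeEquiv x = θ • x) : σ.lam ^ (d - 1) < ‖θ‖ := by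
  by_contra hθ
  have hnot : θ ∉ {θ : ℂ | σ.lam ^ (d - 1) < ‖θ‖} := hθ
  have hx' : (x : Fin m → ℂ) ∈ σ.transposeMap.maxGenEigenspace θ := by
    rw [Module.End.mem_maxGenEigenspace]
    refine ⟨1, ?_⟩
    have : σ.transposeMap x = θ • (x : Fin m → ℂ) := by
      rw [← transposeEquiv_apply, h]; rfl
    simp [this]
  have hd := (σ.transposeMap.independent_maxGenEigenspace).disjoint_biSup hnot
  exact hx (Subtype.ext (Submodule.disjoint_def.mp hd _ hx' x.2))

/-- The vector `(Sᵗ)^{-n} v` of weights of the tiles of order `-n`. -/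
noncomputable def weightVec (v : σ.rapidlyExpanding) (n : ℕ) : Fin m → ℂ :=
  ((σ.transposeEquiv ^ (-(n : ℤ))) v : σ.rapidlyExpanding)

/-- The weight of a tile of order `-n`. -/
noncomputable def weight (v : σ.rapidlyExpanding) (n : ℕ) (t : Tile d m) : ℂ := σ.weightVec v n t.1

lemma transposeMap_weightVec (v : σ.rapidlyExpanding) (n : ℕ) :
    σ.transposeMap (σ.weightVec v (n + 1)) = σ.weightVec v n := by
  rw [weightVec, ← transposeEquiv_apply]
  have : σ.transposeEquiv ((σ.transposeEquiv ^ (-((n + 1 : ℕ) : ℤ))) v) =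
      (σ.transposeEquiv * σ.transposeEquiv ^ (-((n + 1 : ℕ) : ℤ))) v := rfl
  rw [this, ← zpow_one_add]
  simp [weightVec]

lemma weightVec_smul (θ : ℂ) (v : σ.rapidlyExpanding) (n : ℕ) :
    σ.weightVec (θ • v) n = θ • σ.weightVec v n := by
  simp [weightVec]

lemma summable_weightVec (v : σ.rapidlyExpanding) :
    Summable fun n : ℕ => (σ.lam ^ (d - 1)) ^ n * ‖σ.weightVec v n‖ :=
  summable_pow_mul_norm_inv_pow σ.transposeEquiv
    (pow_pos (zero_lt_one.trans σ.one_lt_lam) _)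
    (fun _ _ hx h => σ.lt_norm_of_transposeEquiv_eq_smul hx h) v

/-- Grouping the tiles of ω(T_j) by type turns the matrix product into a sum over tiles. This is
what makes weights additive under subdivision. -/
lemma transposeMap_apply (x : Fin m → ℂ) (j : Fin m) :
    σ.transposeMap x j = ∑ s ∈ σ.sub j, x s.1 := by
  rw [transposeMap, Matrix.toLin'_apply, Matrix.mulVec, dotProduct]
  simp only [Matrix.transpose_apply, Matrix.map_apply, substMatrix]
  rw [← Finset.sum_fiberwise (σ.sub j) (fun s => s.1)]
  refine Finset.sum_congr rfl fun i _ => ?_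
  rw [Finset.sum_congr rfl fun s hs => by rw [(Finset.mem_filter.mp hs).2], Finset.sum_const,
    nsmul_eq_mul]

/-- The patch `ω(t)` of a tile `t`. -/
def children (t : Tile d m) : Finset (Tile d m) :=
  (σ.sub t.1).map ⟨fun s => (s.1, s.2 + σ.φ t.2), fun a b h => by
    simp only [Prod.mk.injEq, add_left_inj] at h
    exact Prod.ext h.1 h.2⟩

lemma mem_children {s t : Tile d m} :
    s ∈ σ.children t ↔ ∃ p ∈ σ.sub t.1, s = (p.1, p.2 + σ.φ t.2) := by
  simp only [children, Finset.mem_map, eq_comm]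
  exact Iff.rfl

lemma mem_inflate {T : Set (Tile d m)} {s : Tile d m} :
    s ∈ σ.inflate T ↔ ∃ t ∈ T, s ∈ σ.children t := by
  simp only [inflate, mem_ofPred_eq, mem_children]

lemma exists_isCellWeight : ∃ M : ℝ, ∀ v : σ.rapidlyExpanding,
    IsCellWeight σ.children (σ.weight v) (fun n => ‖σ.weightVec v n‖) M := by
  -- The total number of tiles in all the ω(T_j) bounds each number of children.
  refine ⟨∑ j, ((σ.sub j).card : ℝ), fun v => ?_⟩
  have hsum : ∀ n j, σ.weightVec v n j = ∑ s ∈ σ.sub j, σ.weightVec v (n + 1) s.1 := by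
    intro n j
    rw [← transposeMap_apply, transposeMap_weightVec]
  have hcard : ∀ j, ((σ.sub j).card : ℝ) ≤ ∑ j, ((σ.sub j).card : ℝ) := fun j =>
    Finset.single_le_sum (f := fun j => ((σ.sub j).card : ℝ)) (fun _ _ => Nat.cast_nonneg _)
      (Finset.mem_univ j)
  refine ⟨fun n t => ?_, fun n t => norm_le_pi_norm (σ.weightVec v n) t.1, fun t => ?_, fun n => ?_,
    fun n => norm_nonneg _⟩
  · rw [children, Finset.sum_map]
    exact hsum n t.1
  · simpa [children] using hcard t.1
  · refine (pi_norm_le_iff_of_nonneg (by positivity)).mpr fun j => ?_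
    rw [hsum]
    refine (norm_sum_le_of_le _ fun s _ => norm_le_pi_norm (σ.weightVec v (n + 1)) s.1).trans ?_
    rw [Finset.sum_const, nsmul_eq_mul]
    exact mul_le_mul_of_nonneg_right (hcard j) (norm_nonneg _)

/-! ## The cells of the tiles of all orders -/

/-- The tiles of `T` have pairwise disjoint interiors. -/
def HasDisjointInteriors (T : Set (Tile d m)) : Prop :=
  T.Pairwise fun s t => Disjoint (interior (σ.supp s)) (interior (σ.supp t))

/-- The interior of the tile `φ^{-n} t` of order `-n`. -/
def cell (n : ℕ) (t : Tile d m) : Set (EuclideanSpace ℝ (Fin d)) :=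
  interior (σ.orderSupp (-(n : ℤ)) t)

lemma zpow_φ_add_apply (k l : ℤ) (x : EuclideanSpace ℝ (Fin d)) :
    (σ.φ ^ (k + l)) x = (σ.φ ^ k) ((σ.φ ^ l) x) := by
  rw [zpow_add]; rfl

lemma image_zpow_φ_add (k l : ℤ) (F : Set (EuclideanSpace ℝ (Fin d))) :
    (σ.φ ^ (k + l)) '' F = (σ.φ ^ k) '' ((σ.φ ^ l) '' F) := by
  rw [image_image]
  exact image_congr fun x _ => σ.zpow_φ_add_apply k l x

lemma norm_zpow_neg_φ (n : ℕ) (x : EuclideanSpace ℝ (Fin d)) :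
    ‖(σ.φ ^ (-(n : ℤ))) x‖ = (σ.lam⁻¹) ^ n * ‖x‖ := by
  induction n generalizing x with
  | zero => simp
  | succ n ih =>
    have h1 : ‖(σ.φ ^ (-1 : ℤ)) x‖ = σ.lam⁻¹ * ‖x‖ := by
      have h2 : σ.φ ((σ.φ ^ (-1 : ℤ)) x) = x := by
        rw [zpow_neg_one]; exact σ.φ.apply_symm_apply x
      have h3 := σ.norm_φ ((σ.φ ^ (-1 : ℤ)) x)
      rw [h2] at h3
      rw [h3, inv_mul_cancel_left₀ (zero_lt_one.trans σ.one_lt_lam).ne']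
    rw [show -((n + 1 : ℕ) : ℤ) = -(n : ℤ) + -1 by push_cast; ring, zpow_φ_add_apply, ih, h1,
      pow_succ]
    ring

/-- The powers of the expansion as homeomorphisms. -/
noncomputable def homeo (k : ℤ) : EuclideanSpace ℝ (Fin d) ≃ₜ EuclideanSpace ℝ (Fin d) :=
  (σ.φ ^ k).toContinuousLinearEquiv.toHomeomorph

lemma image_zpow_interior (k : ℤ) (F : Set (EuclideanSpace ℝ (Fin d))) :
    (σ.φ ^ k) '' interior F = interior ((σ.φ ^ k) '' F) :=
  (σ.homeo k).image_interior F

lemma image_φ_interior (F : Set (EuclideanSpace ℝ (Fin d))) :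
    σ.φ '' interior F = interior (σ.φ '' F) := by
  simpa using σ.image_zpow_interior 1 F

lemma closure_interior_supp (t : Tile d m) : closure (interior (σ.supp t)) = σ.supp t := by
  have h1 := (Homeomorph.addRight t.2).image_interior (σ.A t.1)
  have h2 := (Homeomorph.addRight t.2).image_closure (interior (σ.A t.1))
  rw [σ.closure_interior_A, h1] at h2
  exact h2.symm

lemma closure_interior_orderSupp (k : ℤ) (t : Tile d m) :
    closure (interior (σ.orderSupp k t)) = σ.orderSupp k t := by
  have h2 := (σ.homeo k).image_closure (interior (σ.supp t))
  rw [σ.closure_interior_supp, (σ.homeo k).image_interior] at h2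
  exact h2.symm

lemma supp_nonempty (t : Tile d m) : (σ.supp t).Nonempty := (σ.nonempty_A t.1).image _

lemma interior_orderSupp_nonempty (k : ℤ) (t : Tile d m) :
    (interior (σ.orderSupp k t)).Nonempty := by
  rw [← closure_nonempty_iff, σ.closure_interior_orderSupp]
  exact (σ.supp_nonempty t).image _

lemma supp_subset_of_mem_children {s t : Tile d m} (h : s ∈ σ.children t) :
    σ.supp s ⊆ σ.φ '' σ.supp t := by
  obtain ⟨p, hp, rfl⟩ := σ.mem_children.mp h
  rintro _ ⟨a, ha, rfl⟩
  have hmem : a + p.2 ∈ σ.φ '' σ.A t.1 := by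
    rw [← σ.supp_sub]
    exact mem_biUnion (x := p) hp ⟨a, ha, rfl⟩
  obtain ⟨b, hb, hab⟩ := hmem
  refine ⟨b + t.2, ⟨b, hb, rfl⟩, ?_⟩
  rw [map_add, hab, add_assoc]

lemma orderSupp_subset_of_mem_children {s t : Tile d m} (h : s ∈ σ.children t) (n : ℕ) :
    σ.orderSupp (-((n + 1 : ℕ) : ℤ)) s ⊆ σ.orderSupp (-(n : ℤ)) t := by
  rw [orderSupp, orderSupp, show -(n : ℤ) = -((n + 1 : ℕ) : ℤ) + 1 by push_cast; ring,
    image_zpow_φ_add, zpow_one]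
  exact image_mono (σ.supp_subset_of_mem_children h)

-- Children of one tile are separated by `disjoint_sub`, children of two tiles by the inflated
-- interiors of their parents. The measures are built for any family with disjoint interiors, so
-- those of ω(T) and T - y are available without placing these families in the tiling space.
variable {σ} in
lemma HasDisjointInteriors.inflate {T : Set (Tile d m)} (hT : σ.HasDisjointInteriors T) :
    σ.HasDisjointInteriors (σ.inflate T) := by
  intro s hs s' hs' hne
  obtain ⟨t, ht, hst⟩ := σ.mem_inflate.mp hs
  obtain ⟨t', ht', hst'⟩ := σ.mem_inflate.mp hs'
  rcases eq_or_ne t t' with rfl | htt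
  · obtain ⟨p, hp, rfl⟩ := σ.mem_children.mp hst
    obtain ⟨p', hp', rfl⟩ := σ.mem_children.mp hst'
    have hpp : p ≠ p' := fun h => hne (by rw [h])
    have hsupp : ∀ q : Tile d m, interior (σ.supp (q.1, q.2 + σ.φ t.2)) =
        (fun x => x + σ.φ t.2) '' interior (σ.supp q) := by
      intro q
      have h := (Homeomorph.addRight (σ.φ t.2)).image_interior (σ.supp q)
      refine Eq.trans (congrArg interior ?_) h.symm
      simp only [supp, Homeomorph.coe_addRight, image_image, add_assoc]
    rw [hsupp, hsupp, disjoint_image_iff (add_left_injective _)]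
    exact σ.disjoint_sub t.1 hp hp' hpp
  · have h : Disjoint (interior (σ.supp t)) (interior (σ.supp t')) := hT ht ht' htt
    rw [← disjoint_image_iff σ.φ.injective, image_φ_interior, image_φ_interior] at h
    exact h.mono (interior_mono (σ.supp_subset_of_mem_children hst))
      (interior_mono (σ.supp_subset_of_mem_children hst'))

variable {σ} in
lemma HasDisjointInteriors.iterate {T : Set (Tile d m)} (hT : σ.HasDisjointInteriors T) (n : ℕ) :
    σ.HasDisjointInteriors (σ.inflate^[n] T) := by
  induction n with
  | zero => exact hT
  | succ n ih =>
    rw [Function.iterate_succ_apply']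
    exact ih.inflate

variable {σ} in
lemma HasDisjointInteriors.translate {T : Set (Tile d m)} (hT : σ.HasDisjointInteriors T)
    (y : EuclideanSpace ℝ (Fin d)) : σ.HasDisjointInteriors (translateTiles T y) := by
  rintro _ ⟨s, hs, rfl⟩ _ ⟨t, ht, rfl⟩ hne
  have hst : s ≠ t := fun h => hne (by rw [h])
  have hsupp : ∀ q : Tile d m, interior (σ.supp (q.1, q.2 - y)) =
      (fun x => x + -y) '' interior (σ.supp q) := by
    intro q
    have h := (Homeomorph.addRight (-y)).image_interior (σ.supp q)
    refine Eq.trans (congrArg interior ?_) h.symm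
    simp only [supp, Homeomorph.coe_addRight, image_image, add_assoc, sub_eq_add_neg]
  rw [hsupp, hsupp, disjoint_image_iff (add_left_injective _)]
  exact hT hs ht hst

variable {σ} in
lemma HasDisjointInteriors.isCellHierarchy {T : Set (Tile d m)} (hT : σ.HasDisjointInteriors T) :
    IsCellHierarchy (fun n => σ.inflate^[n] T) σ.cell σ.children where
  cell_nonempty n t _ := σ.interior_orderSupp_nonempty _ t
  pairwiseDisjoint n s hs t ht hne := by
    have h : Disjoint (interior (σ.supp s)) (interior (σ.supp t)) := hT.iterate n hs ht hne
    rw [← disjoint_image_iff (σ.φ ^ (-(n : ℤ))).injective, image_zpow_interior,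
      image_zpow_interior] at h
    exact h
  mem_of_mem_children n t ht s hs := by
    rw [Function.iterate_succ_apply']
    exact σ.mem_inflate.mpr ⟨t, ht, hs⟩
  exists_parent n s hs := by
    rw [Function.iterate_succ_apply'] at hs
    exact σ.mem_inflate.mp hs
  cell_subset n t _ s hs := interior_mono (σ.orderSupp_subset_of_mem_children hs n)

/-! ## Counting tiles by volume -/

lemma exists_ball_subset_cell : ∃ r : ℝ, 0 < r ∧ ∀ (n : ℕ) (t : Tile d m),
    ∃ x, Metric.ball x (r * σ.lam⁻¹ ^ n) ⊆ σ.cell n t := by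
  have hball : ∀ j, ∃ x, ∃ r > 0, Metric.ball x r ⊆ interior (σ.A j) := by
    intro j
    have hne : (interior (σ.A j)).Nonempty := by
      rw [← closure_nonempty_iff, σ.closure_interior_A]
      exact σ.nonempty_A j
    obtain ⟨x, hx⟩ := hne
    exact ⟨x, Metric.isOpen_iff.mp isOpen_interior x hx⟩
  choose x r hr hx using hball
  -- A small enough radius serves all types at once, also when there are no types to minimize over.
  have hev : ∀ᶠ e : ℝ in 𝓝[>] 0, ∀ j, e ≤ r j := by
    rw [eventually_all]
    intro j
    filter_upwards [Ioo_mem_nhdsGT (hr j)] with e he using he.2.le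
  obtain ⟨e, he, he0⟩ := (hev.and self_mem_nhdsWithin).exists
  refine ⟨e, he0, fun n t => ⟨(σ.φ ^ (-(n : ℤ))) (x t.1 + t.2), ?_⟩⟩
  refine interior_maximal (fun y hy => ?_) Metric.isOpen_ball
  obtain ⟨z, rfl⟩ := (σ.φ ^ (-(n : ℤ))).surjective y
  refine ⟨z, ⟨z - t.2, interior_subset (hx t.1 ?_), sub_add_cancel _ _⟩, rfl⟩
  have hlam : 0 < σ.lam⁻¹ ^ n := pow_pos (inv_pos.mpr (zero_lt_one.trans σ.one_lt_lam)) n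
  rw [Metric.mem_ball, dist_eq_norm, ← map_sub, norm_zpow_neg_φ, mul_comm,
    mul_lt_mul_iff_of_pos_right hlam] at hy
  rw [Metric.mem_ball, dist_eq_norm, sub_sub, add_comm t.2]
  exact hy.trans_le (he t.1)

lemma exists_dist_le : ∃ D : ℝ, 0 < D ∧ ∀ (n : ℕ) (t : Tile d m),
    ∀ x ∈ σ.orderSupp (-(n : ℤ)) t, ∀ y ∈ σ.orderSupp (-(n : ℤ)) t,
      dist x y ≤ D * σ.lam⁻¹ ^ n := by
  -- The summand 1 makes the constant positive, as needed for it to serve as a thickening radius.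
  refine ⟨(∑ j, Metric.diam (σ.A j)) + 1,
    add_pos_of_nonneg_of_pos (Finset.sum_nonneg fun _ _ => Metric.diam_nonneg) one_pos, ?_⟩
  rintro n t _ ⟨_, ⟨a, ha, rfl⟩, rfl⟩ _ ⟨_, ⟨b, hb, rfl⟩, rfl⟩
  have hlam : 0 < σ.lam⁻¹ ^ n := pow_pos (inv_pos.mpr (zero_lt_one.trans σ.one_lt_lam)) n
  rw [dist_eq_norm, ← map_sub, norm_zpow_neg_φ, add_sub_add_right_eq_sub, mul_comm,
    ← dist_eq_norm]
  refine mul_le_mul_of_nonneg_right ?_ hlam.le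
  have h1 := Metric.dist_le_diam_of_mem (σ.isCompact_A t.1).isBounded ha hb
  have h2 := Finset.single_le_sum (f := fun j => Metric.diam (σ.A j))
    (fun _ _ => Metric.diam_nonneg) (Finset.mem_univ t.1)
  linarith

lemma _root_.Set.finite_and_ncard_mul_le {α : Type*} {Q : Set α} {c V : ℝ} (hc : 0 < c)
    (h : ∀ s : Finset α, (s : Set α) ⊆ Q → s.card * c ≤ V) : Q.Finite ∧ Q.ncard * c ≤ V := by
  have hfin : Q.Finite := by
    by_contra hinf
    obtain ⟨N, hN⟩ := exists_nat_gt (V / c)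
    obtain ⟨s, hs, hcard⟩ := Set.Infinite.exists_subset_card_eq hinf N
    have := h s hs
    rw [hcard] at this
    rw [div_lt_iff₀ hc] at hN
    linarith
  refine ⟨hfin, ?_⟩
  have := h hfin.toFinset (by simp)
  rwa [← Set.ncard_eq_toFinset_card _ hfin] at this

/-- The number of tiles of order `-n` in a region is bounded in terms of the volume. -/
lemma exists_ncard_mul_le : ∃ c : ℝ, 0 < c ∧ ∀ T : Set (Tile d m), σ.HasDisjointInteriors T →
    ∀ (n : ℕ) (Q : Set (Tile d m)) (K : Set (EuclideanSpace ℝ (Fin d))) (V : ℝ), 0 ≤ V →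
      Q ⊆ σ.inflate^[n] T → (∀ t ∈ Q, σ.cell n t ⊆ K) → volume K ≤ ENNReal.ofReal V →
        Q.Finite ∧ Q.ncard * (c * (σ.lam⁻¹ ^ n) ^ d) ≤ V := by
  obtain ⟨r, hr, hball⟩ := σ.exists_ball_subset_cell
  set u : ENNReal := volume (Metric.ball (0 : EuclideanSpace ℝ (Fin d)) 1) with hu
  have hu0 : u ≠ 0 := (Metric.measure_ball_pos _ _ one_pos).ne'
  have hut : u ≠ ⊤ := measure_ball_lt_top.ne
  have hlam : 0 < σ.lam⁻¹ := inv_pos.mpr (zero_lt_one.trans σ.one_lt_lam)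
  refine ⟨r ^ d * u.toReal, mul_pos (pow_pos hr _) (ENNReal.toReal_pos hu0 hut), ?_⟩
  intro T hT n Q K V hV hQ hK hvol
  have hpos : 0 < r ^ d * u.toReal * (σ.lam⁻¹ ^ n) ^ d :=
    mul_pos (mul_pos (pow_pos hr _) (ENNReal.toReal_pos hu0 hut)) (by positivity)
  refine Set.finite_and_ncard_mul_le hpos fun s hs => ?_
  have hcell : ∀ t, ENNReal.ofReal (r ^ d * u.toReal * (σ.lam⁻¹ ^ n) ^ d)
      ≤ volume (σ.cell n t) := by
    intro t
    obtain ⟨x, hx⟩ := hball n t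
    refine le_trans (le_of_eq ?_) (measure_mono hx)
    rw [Measure.addHaar_ball_of_pos _ _ (by positivity), ← hu, ← ENNReal.ofReal_toReal hut,
      ← ENNReal.ofReal_mul (by positivity), ENNReal.toReal_ofReal ENNReal.toReal_nonneg]
    congr 1
    rw [finrank_euclideanSpace_fin]
    ring
  -- Disjoint cells inside `K`, each containing a ball of radius `r * σ.lam⁻¹ ^ n`, have total
  -- volume at most that of `K`.
  have hdis : (s : Set (Tile d m)).PairwiseDisjoint (σ.cell n) :=
    (hT.isCellHierarchy.pairwiseDisjoint n).subset (hs.trans hQ)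
  have h1 : ∑ t ∈ s, volume (σ.cell n t) ≤ ENNReal.ofReal V := by
    rw [← measure_biUnion_finset hdis fun t _ => isOpen_interior.measurableSet]
    exact (measure_mono (iUnion₂_subset fun t ht => hK t (hs ht))).trans hvol
  have h2 := (Finset.card_nsmul_le_sum s _ _ fun t _ => hcell t).trans h1
  rw [← ENNReal.ofReal_nsmul, ENNReal.ofReal_le_ofReal_iff hV, nsmul_eq_mul] at h2
  exact h2

/-! ## Sets with boundary of codimension one -/

/-- The bounded sets whose boundary has finite `(d-1)`-dimensional upper Minkowski content. -/
def minkowskiRing (d : ℕ) : Set (Set (EuclideanSpace ℝ (Fin d))) :=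
  {F | Bornology.IsBounded F ∧ ∃ C : ℝ, ∀ r ∈ Ioc (0 : ℝ) 1,
    volume (Metric.cthickening r (frontier F)) ≤ ENNReal.ofReal (C * r)}

lemma mem_minkowskiRing_of_frontier_subset {F G H : Set (EuclideanSpace ℝ (Fin d))}
    (hH : Bornology.IsBounded H) (hfr : frontier H ⊆ frontier F ∪ frontier G)
    (hF : F ∈ minkowskiRing d) (hG : G ∈ minkowskiRing d) : H ∈ minkowskiRing d := by
  obtain ⟨-, C, hC⟩ := hF
  obtain ⟨-, C', hC'⟩ := hG
  refine ⟨hH, max C 0 + max C' 0, fun r hr => ?_⟩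
  have h1 := (hC r hr).trans (ENNReal.ofReal_le_ofReal
    (mul_le_mul_of_nonneg_right (le_max_left C 0) hr.1.le))
  have h2 := (hC' r hr).trans (ENNReal.ofReal_le_ofReal
    (mul_le_mul_of_nonneg_right (le_max_left C' 0) hr.1.le))
  calc volume (Metric.cthickening r (frontier H))
      ≤ volume (Metric.cthickening r (frontier F) ∪ Metric.cthickening r (frontier G)) := by
        rw [← Metric.cthickening_union]
        exact measure_mono (Metric.cthickening_subset_of_subset _ hfr)
    _ ≤ _ := (measure_union_le _ _).trans (add_le_add h1 h2)
    _ = _ := by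
        rw [add_mul, ENNReal.ofReal_add] <;> exact mul_nonneg (le_max_right _ _) hr.1.le

lemma isSetRing_minkowskiRing : IsSetRing (minkowskiRing d) where
  empty_mem := ⟨Bornology.isBounded_empty, 0, fun r _ => by simp⟩
  union_mem F G hF hG := mem_minkowskiRing_of_frontier_subset (hF.1.union hG.1)
    ((frontier_union_subset F G).trans
      (union_subset_union inter_subset_left inter_subset_right)) hF hG
  sdiff_mem F G hF hG := mem_minkowskiRing_of_frontier_subset (hF.1.subset sdiff_subset)
    (by
      rw [sdiff_eq, ← frontier_compl G]
      exact (frontier_inter_subset F Gᶜ).trans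
        (union_subset_union inter_subset_left inter_subset_right)) hF hG

/-- A subset N of ∂Ω has its frontier inside the closed set ∂Ω, so it inherits the volume bound of
Ω. -/
lemma lipschitzRing_subset_minkowskiRing : lipschitzRing d ⊆ minkowskiRing d := by
  refine fun A hA => hA _ isSetRing_minkowskiRing fun Ω hΩ => ?_
  have h : Ω ∈ minkowskiRing d := ⟨hΩ.isBounded, hΩ.minkowski⟩
  refine ⟨h, fun N hN => mem_minkowskiRing_of_frontier_subset ?_ ?_ h h⟩
  · exact (hΩ.isBounded.closure.subset frontier_subset_closure).subset hN
  · rw [union_self]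
    exact frontier_subset_closure.trans (closure_minimal hN isClosed_frontier)

lemma mem_lipschitzRing {Ω : Set (EuclideanSpace ℝ (Fin d))} (hΩ : IsLipschitzDomain Ω) :
    Ω ∈ lipschitzRing d := fun _ _ h => (h Ω hΩ).1

/-- The segment from `x` to `y` is connected, so it cannot be split between the interior and the
exterior of `F`. -/
lemma exists_mem_frontier_dist_le {E : Type*} [NormedAddCommGroup E] [NormedSpace ℝ E] {F : Set E}
    {x y : E} (hx : x ∈ F) (hy : y ∉ F) : ∃ z ∈ frontier F, dist x z ≤ dist x y := by
  have hseg : ∃ z ∈ segment ℝ x y, z ∈ frontier F := by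
    by_contra! h
    have hcov : segment ℝ x y ⊆ interior F ∪ (closure F)ᶜ := by
      intro z hz
      by_cases hzi : z ∈ interior F
      · exact Or.inl hzi
      · exact Or.inr fun hzc => h z hz ⟨hzc, hzi⟩
    have hx' : x ∈ interior F := (hcov (left_mem_segment ℝ x y)).resolve_right
      fun h => h (subset_closure hx)
    have hy' : y ∈ (closure F)ᶜ := (hcov (right_mem_segment ℝ x y)).resolve_left
      fun h => hy (interior_subset h)
    obtain ⟨z, -, hz1, hz2⟩ := (convex_segment x y).isPreconnected _ _ isOpen_interior
      isClosed_closure.isOpen_compl hcov ⟨x, left_mem_segment ℝ x y, hx'⟩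
      ⟨y, right_mem_segment ℝ x y, hy'⟩
    exact hz2 (interior_subset_closure hz1)
  obtain ⟨z, hz, hzF⟩ := hseg
  refine ⟨z, hzF, ?_⟩
  have := dist_add_dist_of_mem_segment hz
  linarith [dist_nonneg (x := z) (y := y)]

/-- A set in `minkowskiRing` cuts `O(λ^{n(d-1)})` tiles of order `-n`. -/
lemma exists_ncard_cut_le (hd : 1 ≤ d) {T : Set (Tile d m)} (hT : σ.HasDisjointInteriors T)
    {F : Set (EuclideanSpace ℝ (Fin d))} (hF : F ∈ minkowskiRing d) :
    ∃ C : ℝ, ∀ᶠ n : ℕ in atTop, ∀ Q ⊆ σ.inflate^[n] T,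
      (∀ t ∈ Q, ¬ σ.orderSupp (-(n : ℤ)) t ⊆ F ∧ ¬ Disjoint (σ.orderSupp (-(n : ℤ)) t) F) →
        Q.Finite ∧ Q.ncard ≤ C * (σ.lam ^ (d - 1)) ^ n := by
  obtain ⟨c, hc, hcount⟩ := σ.exists_ncard_mul_le
  obtain ⟨D, hD, hdist⟩ := σ.exists_dist_le
  obtain ⟨-, C, hC⟩ := hF
  have hlam := zero_lt_one.trans σ.one_lt_lam
  -- The Minkowski bound is available only for radii at most 1.
  have hev : ∀ᶠ n : ℕ in atTop, D * σ.lam⁻¹ ^ n ≤ 1 := by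
    have h := (tendsto_pow_atTop_nhds_zero_of_lt_one (inv_pos.mpr hlam).le
      (inv_lt_one_of_one_lt₀ σ.one_lt_lam)).const_mul D
    rw [mul_zero] at h
    exact (h.eventually_lt_const one_pos).mono fun n hn => hn.le
  refine ⟨max C 0 * D / c, hev.mono fun n hn Q hQ hcut => ?_⟩
  have hρ : 0 < σ.lam⁻¹ ^ n := pow_pos (inv_pos.mpr hlam) n
  -- A cut tile has points inside and outside `F`, so each of its points is within the tile's
  -- diameter of the frontier.
  have hsub : ∀ t ∈ Q, σ.cell n t ⊆ Metric.cthickening (D * σ.lam⁻¹ ^ n) (frontier F) := by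
    intro t ht x hx
    have hx' := interior_subset hx
    obtain ⟨h1, h2⟩ := hcut t ht
    obtain ⟨a, ha, haF⟩ := Set.not_subset.mp h1
    obtain ⟨b, hb, hbF⟩ := Set.not_disjoint_iff.mp h2
    have key : ∃ z ∈ frontier F, dist x z ≤ D * σ.lam⁻¹ ^ n := by
      by_cases hxF : x ∈ F
      · obtain ⟨z, hz, hxz⟩ := exists_mem_frontier_dist_le hxF haF
        exact ⟨z, hz, hxz.trans (hdist n t x hx' a ha)⟩
      · obtain ⟨z, hz, hxz⟩ := exists_mem_frontier_dist_le (F := Fᶜ) hxF (not_not.mpr hbF)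
        exact ⟨z, frontier_compl F ▸ hz, hxz.trans (hdist n t x hx' b hb)⟩
    obtain ⟨z, hz, hxz⟩ := key
    exact Metric.mem_cthickening_of_dist_le x z _ _ hz hxz
  have hvol := (hC _ ⟨mul_pos hD hρ, hn⟩).trans (ENNReal.ofReal_le_ofReal
    (mul_le_mul_of_nonneg_right (le_max_left C 0) (mul_pos hD hρ).le))
  obtain ⟨hfin, hcard⟩ := hcount T hT n Q _ _ (by positivity) hQ hsub hvol
  refine ⟨hfin, ?_⟩
  have hpow : (σ.lam ^ (d - 1)) ^ n * (σ.lam⁻¹ ^ n) ^ d = σ.lam⁻¹ ^ n := by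
    obtain ⟨e, rfl⟩ : ∃ e, d = e + 1 := ⟨d - 1, by omega⟩
    rw [Nat.add_sub_cancel, pow_succ, ← mul_assoc, ← pow_mul, mul_comm e n, pow_mul, ← mul_pow,
      ← mul_pow, mul_inv_cancel₀ hlam.ne', one_pow, one_pow, one_mul]
  have hpos : 0 < c * (σ.lam⁻¹ ^ n) ^ d := by positivity
  refine le_of_mul_le_mul_right (hcard.trans (le_of_eq ?_)) hpos
  calc max C 0 * (D * σ.lam⁻¹ ^ n)
      = max C 0 * D * ((σ.lam ^ (d - 1)) ^ n * (σ.lam⁻¹ ^ n) ^ d) := by rw [hpow]; ring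
    _ = _ := by field_simp

lemma minkowskiRing_subset_negligibleCut (hd : 1 ≤ d) {T : Set (Tile d m)}
    (hT : σ.HasDisjointInteriors T) (v : σ.rapidlyExpanding) :
    minkowskiRing d ⊆
      negligibleCut (fun n => σ.inflate^[n] T) σ.cell fun n => ‖σ.weightVec v n‖ := by
  intro F hF
  obtain ⟨C, hC⟩ := σ.exists_ncard_cut_le hd hT hF
  obtain ⟨c, -, hcount⟩ := σ.exists_ncard_mul_le
  have hlam := zero_lt_one.trans σ.one_lt_lam
  have hcut : ∀ᶠ n : ℕ in atTop, (cutCells (fun n => σ.inflate^[n] T) σ.cell n F).Finite ∧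
      (cutCells (fun n => σ.inflate^[n] T) σ.cell n F).ncard ≤ C * (σ.lam ^ (d - 1)) ^ n := by
    filter_upwards [hC] with n hn
    refine hn _ (fun t ht => ht.1) fun t ht => ⟨fun h => ht.2.1 (interior_subset.trans h),
      fun h => ht.2.2 (h.mono_left interior_subset)⟩
  refine ⟨hcut.mono fun n hn => ⟨?_, hn.1⟩, ?_⟩
  · exact (hcount T hT n _ F _ ENNReal.toReal_nonneg (fun t ht => ht.1) (fun t ht => ht.2)
      (ENNReal.ofReal_toReal hF.1.measure_lt_top.ne).ge).1
  -- The cut at level `n` is paired with the weights of level `n + 1`; the factor `(σ.lam ^ (d -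
  -- 1))⁻¹` compensates for the shift.
  · have hs := ((summable_nat_add_iff 1).mpr (σ.summable_weightVec v)).mul_left
      (C * (σ.lam ^ (d - 1))⁻¹)
    refine Summable.of_norm_bounded_eventually_nat hs ?_
    filter_upwards [hcut] with n hn
    rw [Real.norm_of_nonneg (by positivity)]
    refine (mul_le_mul_of_nonneg_right hn.2 (norm_nonneg _)).trans (le_of_eq ?_)
    rw [pow_succ]
    have : σ.lam ^ (d - 1) ≠ 0 := (pow_pos hlam _).ne'
    field_simp

/-! ## The measure of the tiles of all orders -/

/-- The limit over `n` of the total weights of the tiles of order `-n` whose interiors are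
contained in `F`. -/
noncomputable def tileMeasure (v : σ.rapidlyExpanding) (T : Set (Tile d m))
    (F : Set (EuclideanSpace ℝ (Fin d))) : ℂ :=
  limUnder atTop fun n => cellSum (fun n => σ.inflate^[n] T) σ.cell (σ.weight v) n F

variable {σ} in
lemma HasDisjointInteriors.tendsto_tileMeasure {T : Set (Tile d m)}
    (hT : σ.HasDisjointInteriors T) {v : σ.rapidlyExpanding}
    {F : Set (EuclideanSpace ℝ (Fin d))}
    (hF : F ∈ negligibleCut (fun n => σ.inflate^[n] T) σ.cell fun n => ‖σ.weightVec v n‖) :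
    Tendsto (fun n => cellSum (fun n => σ.inflate^[n] T) σ.cell (σ.weight v) n F) atTop
      (𝓝 (σ.tileMeasure v T F)) := by
  obtain ⟨M, hM⟩ := σ.exists_isCellWeight
  exact hT.isCellHierarchy.tendsto_cellSum (hM v) hF

lemma tileMeasure_eq_zero {v : σ.rapidlyExpanding} {T : Set (Tile d m)}
    {F : Set (EuclideanSpace ℝ (Fin d))} (hF : interior F = ∅) : σ.tileMeasure v T F = 0 := by
  have h : ∀ n, cellSum (fun n => σ.inflate^[n] T) σ.cell (σ.weight v) n F = 0 := by
    intro n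
    have : innerCells (fun n => σ.inflate^[n] T) σ.cell n F = ∅ := by
      refine eq_empty_of_forall_notMem fun t ht => ?_
      obtain ⟨x, hx⟩ := σ.interior_orderSupp_nonempty (-(n : ℤ)) t
      have := interior_maximal ht.2 isOpen_interior hx
      simp [hF] at this
    simp [cellSum, this]
  simp only [tileMeasure, h]
  exact tendsto_const_nhds.limUnder_eq

lemma tileMeasure_smul {T : Set (Tile d m)} (hT : σ.HasDisjointInteriors T)
    (v : σ.rapidlyExpanding) (θ : ℂ) {F : Set (EuclideanSpace ℝ (Fin d))}
    (hF : F ∈ negligibleCut (fun n => σ.inflate^[n] T) σ.cell fun n => ‖σ.weightVec v n‖) :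
    σ.tileMeasure (θ • v) T F = θ * σ.tileMeasure v T F := by
  refine Tendsto.limUnder_eq (((hT.tendsto_tileMeasure hF).const_mul θ).congr' ?_)
  filter_upwards [hF.1] with n hn
  rw [cellSum, cellSum, finsum_mem_eq_finite_toFinset_sum _ hn.1,
    finsum_mem_eq_finite_toFinset_sum _ hn.1, Finset.mul_sum]
  refine Finset.sum_congr rfl fun t _ => ?_
  simp [weight, weightVec_smul]

/-- In a tiling of order `k`, the interior of a tile is contained in
`(supp P \ N₁) ∪ N₂` or disjoint from it, according to whether the tile is in `P`. -/
lemma interior_orderSupp_subset_or_disjoint {S : Set (Tile d m)} (hS : σ.HasDisjointInteriors S)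
    (k : ℤ) {P : Set (Tile d m)} (hP : P ⊆ S) {N₁ N₂ : Set (EuclideanSpace ℝ (Fin d))}
    (hN₁ : N₁ ⊆ ⋃ t ∈ S, frontier (σ.orderSupp k t))
    (hN₂ : N₂ ⊆ ⋃ t ∈ S, frontier (σ.orderSupp k t)) {t : Tile d m} (ht : t ∈ S) :
    (t ∈ P → interior (σ.orderSupp k t) ⊆ ((⋃ t ∈ P, σ.orderSupp k t) \ N₁) ∪ N₂) ∧
      (t ∉ P → Disjoint (interior (σ.orderSupp k t))
        (((⋃ t ∈ P, σ.orderSupp k t) \ N₁) ∪ N₂)) := by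
  have hsupp : ∀ s ∈ S, s ≠ t → Disjoint (interior (σ.orderSupp k t)) (σ.orderSupp k s) := by
    intro s hs hne
    have h : Disjoint (interior (σ.supp t)) (interior (σ.supp s)) := hS ht hs hne.symm
    rw [← disjoint_image_iff (σ.φ ^ k).injective, image_zpow_interior, image_zpow_interior] at h
    -- An open set disjoint from the interior of a tile misses its closure, which is the whole tile.
    have h' := h.closure_right isOpen_interior
    rwa [← orderSupp, ← orderSupp, σ.closure_interior_orderSupp] at h'
  have hclosed : ∀ s, IsClosed (σ.orderSupp k s) := fun s => by
    rw [← σ.closure_interior_orderSupp]; exact isClosed_closure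
  have hbd : Disjoint (interior (σ.orderSupp k t)) (⋃ t ∈ S, frontier (σ.orderSupp k t)) := by
    rw [disjoint_iUnion₂_right]
    intro s hs
    rcases eq_or_ne s t with rfl | hne
    · exact disjoint_interior_frontier
    · exact (hsupp s hs hne).mono_right (hclosed s).frontier_subset
  refine ⟨fun htP x hx => Or.inl ⟨mem_biUnion htP (interior_subset hx), fun hxN =>
    hbd.le_bot ⟨hx, hN₁ hxN⟩⟩, fun htP => ?_⟩
  rw [disjoint_union_right]
  refine ⟨Disjoint.mono_right sdiff_subset ?_, hbd.mono_right hN₂⟩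
  rw [disjoint_iUnion₂_right]
  exact fun s hs => hsupp s (hP hs) fun h => htP (h ▸ hs)

lemma _root_.innerCells_eq_and_cutCells_eq {X ι : Type*} {L : ℕ → Set ι} {cell : ℕ → ι → Set X}
    {n : ℕ} {P : Set ι} {F : Set X} (hne : ∀ t ∈ L n, (cell n t).Nonempty) (hP : P ⊆ L n)
    (h : ∀ t ∈ L n, (t ∈ P → cell n t ⊆ F) ∧ (t ∉ P → Disjoint (cell n t) F)) :
    innerCells L cell n F = P ∧ cutCells L cell n F = ∅ := by
  constructor
  · ext t
    refine ⟨fun ht => ?_, fun ht => ⟨hP ht, (h t (hP ht)).1 ht⟩⟩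
    by_contra htP
    obtain ⟨x, hx⟩ := hne t ht.1
    exact ((h t ht.1).2 htP).le_bot ⟨hx, ht.2 hx⟩
  · refine eq_empty_of_forall_notMem fun t ht => ?_
    by_cases htP : t ∈ P
    · exact ht.2.1 ((h t ht.1).1 htP)
    · exact ht.2.2 ((h t ht.1).2 htP)

lemma cell_eq_image_cell (k n : ℕ) (t : Tile d m) :
    σ.cell n t = (σ.φ ^ (k : ℤ)) '' σ.cell (n + k) t := by
  rw [cell, cell, image_zpow_interior, orderSupp, orderSupp, ← image_zpow_φ_add]
  congr 4
  push_cast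
  ring

/-- The hierarchy of ω^k(T) is that of T without its first k levels, rescaled by φ^k. -/
lemma innerCells_inflate (T : Set (Tile d m)) (k n : ℕ) (F : Set (EuclideanSpace ℝ (Fin d))) :
    innerCells (fun n => σ.inflate^[n] (σ.inflate^[k] T)) σ.cell n ((σ.φ ^ (k : ℤ)) '' F) =
      innerCells (fun n => σ.inflate^[n] T) σ.cell (n + k) F := by
  ext t
  simp only [innerCells, mem_ofPred_eq, Function.iterate_add_apply, σ.cell_eq_image_cell k n t,
    image_subset_image_iff (σ.φ ^ (k : ℤ)).injective]

lemma cutCells_inflate (T : Set (Tile d m)) (k n : ℕ) (F : Set (EuclideanSpace ℝ (Fin d))) :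
    cutCells (fun n => σ.inflate^[n] (σ.inflate^[k] T)) σ.cell n ((σ.φ ^ (k : ℤ)) '' F) =
      cutCells (fun n => σ.inflate^[n] T) σ.cell (n + k) F := by
  ext t
  simp only [cutCells, mem_ofPred_eq, Function.iterate_add_apply, σ.cell_eq_image_cell k n t,
    image_subset_image_iff (σ.φ ^ (k : ℤ)).injective,
    disjoint_image_iff (σ.φ ^ (k : ℤ)).injective]

lemma weight_zpow (v : σ.rapidlyExpanding) (k n : ℕ) (t : Tile d m) :
    σ.weight ((σ.transposeEquiv ^ (k : ℤ)) v) (n + k) t = σ.weight v n t := by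
  have : (σ.transposeEquiv ^ (-((n + k : ℕ) : ℤ))) ((σ.transposeEquiv ^ (k : ℤ)) v) =
      (σ.transposeEquiv ^ (-((n + k : ℕ) : ℤ)) * σ.transposeEquiv ^ (k : ℤ)) v := rfl
  rw [weight, weight, weightVec, weightVec, this, ← zpow_add,
    show -((n + k : ℕ) : ℤ) + (k : ℤ) = -(n : ℤ) by push_cast; ring]

/-- Inflating the tiling and the set amounts to applying `Sᵗ` to the vector. -/
lemma tileMeasure_inflate {T : Set (Tile d m)} (hT : σ.HasDisjointInteriors T) (k : ℕ)
    (v : σ.rapidlyExpanding) {F : Set (EuclideanSpace ℝ (Fin d))}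
    (hF : F ∈ negligibleCut (fun n => σ.inflate^[n] T) σ.cell
      fun n => ‖σ.weightVec ((σ.transposeEquiv ^ (k : ℤ)) v) n‖) :
    σ.tileMeasure v (σ.inflate^[k] T) ((σ.φ ^ (k : ℤ)) '' F) =
      σ.tileMeasure ((σ.transposeEquiv ^ (k : ℤ)) v) T F := by
  refine Tendsto.limUnder_eq ?_
  refine ((tendsto_add_atTop_iff_nat k).mpr (hT.tendsto_tileMeasure hF)).congr fun n => ?_
  rw [cellSum, cellSum, innerCells_inflate]
  exact finsum_mem_congr rfl fun t _ => σ.weight_zpow v k n t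

lemma level_neg (T : Set (Tile d m)) (n : ℕ) : σ.level T (-(n : ℤ)) = σ.inflate^[n] T := by
  simp [level]

lemma level_pos (T : Set (Tile d m)) {n : ℕ} (hn : 0 < n) :
    σ.level T n = ∅ ∨
      ∃ R, σ.HasDisjointInteriors R ∧ σ.inflate^[n] R = T ∧ σ.level T n = R := by
  have hn' : ¬ (n : ℤ) ≤ 0 := by omega
  by_cases h : ∃ R ∈ σ.tilingSpace, σ.inflate^[(n : ℤ).natAbs] R = T
  · refine Or.inr ⟨h.choose, h.choose_spec.1.1.2, h.choose_spec.2, ?_⟩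
    rw [level, if_neg hn', dif_pos h]
  · left
    rw [level, if_neg hn', dif_neg h]

/-- The sets in the ring of tiles of all orders have negligible cut, and their measure is the sum
of the weights of their tiles. -/
lemma tileMeasure_patch {T : Set (Tile d m)} (hT : σ.HasDisjointInteriors T)
    (v : σ.rapidlyExpanding) (k : ℤ) {P : Set (Tile d m)} (hP : P ⊆ σ.level T k) (hfin : P.Finite)
    {N₁ N₂ : Set (EuclideanSpace ℝ (Fin d))} (hN₁ : N₁ ⊆ σ.levelBoundary T k)
    (hN₂ : N₂ ⊆ σ.levelBoundary T k) :
    ((⋃ t ∈ P, σ.orderSupp k t) \ N₁) ∪ N₂ ∈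
        negligibleCut (fun n => σ.inflate^[n] T) σ.cell (fun n => ‖σ.weightVec v n‖) ∧
      σ.tileMeasure v T (((⋃ t ∈ P, σ.orderSupp k t) \ N₁) ∪ N₂) =
        ∑ᶠ t ∈ P, ((σ.transposeEquiv ^ k) v : Fin m → ℂ) t.1 := by
  obtain ⟨M, hM⟩ := σ.exists_isCellWeight
  have hcells := hT.isCellHierarchy
  rcases le_or_gt k 0 with hk | hk
  · obtain ⟨n, rfl⟩ : ∃ n : ℕ, k = -(n : ℤ) := ⟨k.natAbs, by omega⟩
    rw [levelBoundary, level_neg] at hN₁ hN₂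
    rw [level_neg] at hP
    obtain ⟨h1, h2⟩ := innerCells_eq_and_cutCells_eq (L := fun n => σ.inflate^[n] T)
      (cell := σ.cell) (n := n) (hcells.cell_nonempty n) hP
      fun t ht => σ.interior_orderSupp_subset_or_disjoint (hT.iterate n) _ hP hN₁ hN₂ ht
    have hinner := hfin
    rw [← h1] at hinner
    refine ⟨hcells.mem_negligibleCut_of_resolved hinner h2, ?_⟩
    rw [tileMeasure, hcells.limUnder_cellSum_of_resolved (hM v) hinner h2, cellSum, h1]
    rfl
  · obtain ⟨n, rfl⟩ : ∃ n : ℕ, k = n := ⟨k.natAbs, by omega⟩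
    -- If no tiling of order `n` exists, `level` is empty by default and so is the set considered.
    -- Otherwise the set pulled back by φ^{-n} is resolved at level 0 of `R`, and the result is
    -- carried to `T` by inflation.
    rcases σ.level_pos T (n := n) (by omega) with he | ⟨R, hR, hRT, hlev⟩
    · rw [levelBoundary, he] at hN₁ hN₂
      rw [he, subset_empty_iff] at hP
      obtain rfl : N₂ = ∅ := by simpa using hN₂
      subst hP
      simpa using ⟨(hcells.isSetRing_negligibleCut (hM v).bound_nonneg).empty_mem,
        σ.tileMeasure_eq_zero (v := v) (T := T) interior_empty⟩
    · rw [levelBoundary, hlev] at hN₁ hN₂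
      rw [hlev] at hP
      set F := ((⋃ t ∈ P, σ.orderSupp n t) \ N₁) ∪ N₂ with hF
      have himg : (σ.φ ^ (n : ℤ)) '' ((σ.φ ^ (-(n : ℤ))) '' F) = F := by
        rw [← image_zpow_φ_add, add_neg_cancel, zpow_zero]
        exact image_id _
      have hcell : ∀ t, σ.cell 0 t = (σ.φ ^ (-(n : ℤ))) '' interior (σ.orderSupp n t) := by
        intro t
        rw [image_zpow_interior, orderSupp, ← image_zpow_φ_add, neg_add_cancel]
        rfl
      obtain ⟨h1, h2⟩ := innerCells_eq_and_cutCells_eq (L := fun n => σ.inflate^[n] R)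
        (cell := σ.cell) (n := 0) (F := (σ.φ ^ (-(n : ℤ))) '' F)
        (hR.isCellHierarchy.cell_nonempty 0) hP fun t ht => by
          rw [hcell, image_subset_image_iff (σ.φ ^ (-(n : ℤ))).injective,
            disjoint_image_iff (σ.φ ^ (-(n : ℤ))).injective]
          exact σ.interior_orderSupp_subset_or_disjoint hR _ hP hN₁ hN₂ ht
      have hinner := hfin
      rw [← h1] at hinner
      have hres := hR.isCellHierarchy.resolved_of_le hinner h2 (Nat.zero_le n)
      have hi := σ.innerCells_inflate R n 0 ((σ.φ ^ (-(n : ℤ))) '' F)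
      have hc := σ.cutCells_inflate R n 0 ((σ.φ ^ (-(n : ℤ))) '' F)
      rw [himg, hRT, Nat.zero_add] at hi hc
      rw [← hi, ← hc] at hres
      refine ⟨hcells.mem_negligibleCut_of_resolved hres.1 hres.2, ?_⟩
      have hinf := σ.tileMeasure_inflate hR n v
        (hR.isCellHierarchy.mem_negligibleCut_of_resolved hinner h2)
      rw [himg, hRT] at hinf
      rw [hinf, tileMeasure, hR.isCellHierarchy.limUnder_cellSum_of_resolved (hM _) hinner h2,
        cellSum, h1]
      rfl

lemma tileRing_subset_negligibleCut {T : Set (Tile d m)} (hT : σ.HasDisjointInteriors T)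
    (v : σ.rapidlyExpanding) :
    σ.tileRing T ⊆
      negligibleCut (fun n => σ.inflate^[n] T) σ.cell (fun n => ‖σ.weightVec v n‖) := by
  rintro _ ⟨k, P, N₁, N₂, hP, hfin, hN₁, hN₂, rfl⟩
  exact (σ.tileMeasure_patch hT v k hP hfin hN₁ hN₂).1

/-! ## Translations -/

lemma inflate_translateTiles (T : Set (Tile d m)) (y : EuclideanSpace ℝ (Fin d)) :
    σ.inflate (translateTiles T y) = translateTiles (σ.inflate T) (σ.φ y) := by
  ext p
  constructor
  · rintro ⟨_, ⟨t, ht, rfl⟩, s, hs, rfl⟩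
    exact ⟨_, ⟨t, ht, s, hs, rfl⟩, by simp [add_sub_assoc]⟩
  · rintro ⟨_, ⟨t, ht, s, hs, rfl⟩, rfl⟩
    exact ⟨_, ⟨t, ht, rfl⟩, s, hs, by simp [add_sub_assoc]⟩

lemma iterate_inflate_translateTiles (T : Set (Tile d m)) (y : EuclideanSpace ℝ (Fin d)) (n : ℕ) :
    σ.inflate^[n] (translateTiles T y) =
      translateTiles (σ.inflate^[n] T) ((σ.φ ^ (n : ℤ)) y) := by
  induction n with
  | zero => simp
  | succ n ih =>
    rw [Function.iterate_succ_apply', Function.iterate_succ_apply', ih, inflate_translateTiles,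
      show ((n + 1 : ℕ) : ℤ) = 1 + n by push_cast; ring, zpow_φ_add_apply, zpow_one]

lemma cell_translate (n : ℕ) (t : Tile d m) (y : EuclideanSpace ℝ (Fin d)) :
    σ.cell n (t.1, t.2 - (σ.φ ^ (n : ℤ)) y) = (fun x => x + -y) '' σ.cell n t := by
  have h := (Homeomorph.addRight (-y)).image_interior (σ.orderSupp (-(n : ℤ)) t)
  refine Eq.trans (congrArg interior ?_) h.symm
  simp only [orderSupp, supp, Homeomorph.coe_addRight, image_image]
  refine image_congr fun a _ => ?_
  rw [← add_sub_assoc, map_sub, ← zpow_φ_add_apply, neg_add_cancel, zpow_zero, sub_eq_add_neg]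
  rfl

lemma tileMeasure_translate (v : σ.rapidlyExpanding) (T : Set (Tile d m))
    (y : EuclideanSpace ℝ (Fin d)) (F : Set (EuclideanSpace ℝ (Fin d))) :
    σ.tileMeasure v (translateTiles T y) F = σ.tileMeasure v T ((fun x => x + y) '' F) := by
  rw [tileMeasure, tileMeasure]
  -- The sums agree at every level, so the limits agree without any convergence assumption on `F`.
  congr 1
  funext n
  have hinner : innerCells (fun n => σ.inflate^[n] (translateTiles T y)) σ.cell n F =
      (fun t : Tile d m => (t.1, t.2 - (σ.φ ^ (n : ℤ)) y)) ''
        innerCells (fun n => σ.inflate^[n] T) σ.cell n ((fun x => x + y) '' F) := by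
    have hsub : ∀ t : Tile d m, σ.cell n (t.1, t.2 - (σ.φ ^ (n : ℤ)) y) ⊆ F ↔
        σ.cell n t ⊆ (fun x => x + y) '' F := by
      intro t
      rw [cell_translate, image_subset_iff, image_add_right]
    ext p
    simp only [innerCells, iterate_inflate_translateTiles]
    constructor
    · rintro ⟨⟨t, ht, rfl⟩, hp⟩
      exact ⟨t, ⟨ht, (hsub t).mp hp⟩, rfl⟩
    · rintro ⟨t, ⟨ht, hp⟩, rfl⟩
      exact ⟨⟨t, ht, rfl⟩, (hsub t).mpr hp⟩
  rw [cellSum, cellSum, hinner, finsum_mem_image]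
  · rfl
  · rintro ⟨a, x⟩ _ ⟨b, z⟩ _ h
    simpa using h

/-! ## Packings -/

lemma _root_.Filter.Tendsto.atBot_of_comp_neg_natCast {α : Type*} {l : Filter α} {f : ℤ → α}
    (h : Tendsto (fun n : ℕ => f (-(n : ℤ))) atTop l) : Tendsto f atBot l := by
  have ht : Tendsto (fun k : ℤ => (-k).toNat) atBot atTop := by
    refine tendsto_atTop.mpr fun b => ?_
    filter_upwards [eventually_le_atBot (-(b : ℤ))] with k hk
    omega
  refine (h.comp ht).congr' ?_
  filter_upwards [eventually_le_atBot (0 : ℤ)] with k hk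
  simp only [Function.comp_apply]
  congr 1
  omega

/-- The packing asks for closed tiles inside `F`, the measure only for their interiors. A tile
satisfying the second condition but not the first is cut by `F`, so the difference is O(λ^{n(d-1)}
‖(Sᵗ)^{-n} v‖), which tends to 0. -/
lemma tendsto_tileMeasure_packing (hd : 1 ≤ d) {T : Set (Tile d m)}
    (hT : σ.HasDisjointInteriors T) (v : σ.rapidlyExpanding)
    {F : Set (EuclideanSpace ℝ (Fin d))} (hF : F ∈ minkowskiRing d) :
    Tendsto (fun k : ℤ => σ.tileMeasure v T (σ.packing T F k)) atBot
      (𝓝 (σ.tileMeasure v T F)) := by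
  obtain ⟨M, hM⟩ := σ.exists_isCellWeight
  have hneg := σ.minkowskiRing_subset_negligibleCut hd hT v hF
  obtain ⟨C, hC⟩ := σ.exists_ncard_cut_le hd hT hF
  refine Tendsto.atBot_of_comp_neg_natCast ?_
  refine tendsto_of_tendsto_of_dist (hT.tendsto_tileMeasure hneg) ?_
  have h0 := (σ.summable_weightVec v).tendsto_atTop_zero.const_mul C
  rw [mul_zero] at h0
  refine tendsto_of_tendsto_of_tendsto_of_le_of_le' tendsto_const_nhds h0
    (Eventually.of_forall fun n => dist_nonneg) ?_
  filter_upwards [hneg.1, hC] with n hfin hcut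
  set P := {t ∈ σ.level T (-(n : ℤ)) | σ.orderSupp (-(n : ℤ)) t ⊆ F} with hP
  set I := innerCells (fun n => σ.inflate^[n] T) σ.cell n F with hI
  have hPI : P ⊆ I := fun t ht =>
    ⟨by simpa only [level_neg] using ht.1, interior_subset.trans ht.2⟩
  have hpack : σ.tileMeasure v T (σ.packing T F (-(n : ℤ))) = ∑ᶠ t ∈ P, σ.weight v n t := by
    have h := (σ.tileMeasure_patch hT v (-(n : ℤ)) (P := P) (fun t ht => ht.1)
      (hfin.1.subset hPI) (empty_subset _) (empty_subset _)).2
    rw [sdiff_empty, union_empty] at h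
    exact h
  obtain ⟨hQfin, hQ⟩ := hcut (I \ P) (fun t ht => ht.1.1) fun t ht => by
    refine ⟨fun h => ht.2 ⟨by simpa only [level_neg] using ht.1.1, h⟩, ?_⟩
    obtain ⟨x, hx⟩ := σ.interior_orderSupp_nonempty (-(n : ℤ)) t
    exact Set.not_disjoint_iff.mpr ⟨x, interior_subset hx, ht.1.2 hx⟩
  have hsum : cellSum (fun n => σ.inflate^[n] T) σ.cell (σ.weight v) n F =
      ∑ᶠ t ∈ P, σ.weight v n t + ∑ᶠ t ∈ I \ P, σ.weight v n t := by
    rw [cellSum, ← finsum_mem_union disjoint_sdiff_right (hfin.1.subset hPI) hQfin,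
      union_sdiff_cancel hPI]
  rw [hsum, hpack, dist_eq_norm, add_sub_cancel_left]
  refine (IsCellHierarchy.norm_finsum_le (hM v) hQfin).trans ?_
  rw [← mul_assoc]
  exact mul_le_mul_of_nonneg_right hQ (norm_nonneg _)

end TileSubstitution

/-! ### Assembly of the two measures -/

theorem lemma3p2 {d m : ℕ} (hd : 1 ≤ d) (σ : TileSubstitution d m)
    (hprim : σ.IsPrimitive) (hflc : σ.HasFLC) (hnp : σ.IsNonPeriodic) :
    ∃ (Ψ : σ.rapidlyExpanding → (T : Set (Tile d m)) → AddContent ℂ (σ.tileRing T))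
      (Φ : σ.rapidlyExpanding → Set (Tile d m) → AddContent ℂ (lipschitzRing d)),
      ∀ v : σ.rapidlyExpanding, ∀ T ∈ σ.tilingSpace,
        -- the finitely-additive measure on the ring of tiles of all orders
        (∀ (k : ℤ), ∀ t ∈ σ.level T k,
          Ψ v T (σ.orderSupp k t) = ((σ.transposeEquiv ^ k) v : Fin m → ℂ) t.1) ∧
        (∀ (k : ℤ), ∀ N ⊆ σ.levelBoundary T k, Ψ v T N = 0) ∧
        -- the extension to Lipschitz domains and subsets of their boundaries
        (∀ Ω, IsLipschitzDomain Ω →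
          Tendsto (fun k : ℤ => Ψ v T (σ.packing T Ω k)) atBot (𝓝 (Φ v T Ω)) ∧
            ∀ N ⊆ frontier Ω, Φ v T (Ω ∪ N) = Φ v T Ω) ∧
        (∀ F ∈ σ.tileRing T ∩ lipschitzRing d, Φ v T F = Ψ v T F) ∧
        -- the cocycle conditions
        (∀ Ω ∈ lipschitzRing d,
          (∀ y : EuclideanSpace ℝ (Fin d),
            Φ v (translateTiles T y) Ω = Φ v T ((fun x => x + y) '' Ω)) ∧
          Φ (σ.transposeEquiv v) T Ω = Φ v (σ.inflate T) (σ.φ '' Ω) ∧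
          ∀ θ : ℂ, σ.transposeEquiv v = θ • v →
            Φ v (σ.inflate T) (σ.φ '' Ω) = Φ (θ • v) T Ω ∧
            Φ (θ • v) T Ω = θ * Φ v T Ω) := by
  classical
  obtain ⟨M, hM⟩ := σ.exists_isCellWeight
  have hΦ : ∀ {T : Set (Tile d m)}, σ.HasDisjointInteriors T → ∀ v : σ.rapidlyExpanding,
      lipschitzRing d ⊆
        negligibleCut (fun n => σ.inflate^[n] T) σ.cell fun n => ‖σ.weightVec v n‖ :=
    fun hT v => TileSubstitution.lipschitzRing_subset_minkowskiRing.trans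
      (σ.minkowskiRing_subset_negligibleCut hd hT v)
  -- Both measures are total in `T`; the default value is taken only where tiles overlap, never for
  -- a tiling.
  let Ψ : σ.rapidlyExpanding → (T : Set (Tile d m)) → AddContent ℂ (σ.tileRing T) := fun v T =>
    if hT : σ.HasDisjointInteriors T then
      hT.isCellHierarchy.content (hM v) (σ.tileRing_subset_negligibleCut hT v)
    else default
  let Φ : σ.rapidlyExpanding → Set (Tile d m) → AddContent ℂ (lipschitzRing d) := fun v T =>
    if hT : σ.HasDisjointInteriors T then hT.isCellHierarchy.content (hM v) (hΦ hT v)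
    else default
  have hΨ_eq : ∀ v {T}, σ.HasDisjointInteriors T → ∀ F, Ψ v T F = σ.tileMeasure v T F := by
    intro v T hT F
    simp only [Ψ, dif_pos hT]
    rfl
  have hΦ_eq : ∀ v {T}, σ.HasDisjointInteriors T → ∀ F, Φ v T F = σ.tileMeasure v T F := by
    intro v T hT F
    simp only [Φ, dif_pos hT]
    rfl
  refine ⟨Ψ, Φ, fun v T hTX => ?_⟩
  have hT : σ.HasDisjointInteriors T := hTX.1.2
  -- Every value becomes one of `tileMeasure`, so the agreement on the common sets reduces to
  -- `True`.
  simp only [hΨ_eq v hT, hΦ_eq v hT, hΦ_eq _ hT, hΦ_eq _ hT.inflate, hΦ_eq _ (hT.translate _)]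
  have hinflate : ∀ F ∈ lipschitzRing d, σ.tileMeasure (σ.transposeEquiv v) T F =
      σ.tileMeasure v (σ.inflate T) (σ.φ '' F) := fun F hF => by
    have h := σ.tileMeasure_inflate hT 1 v (hΦ hT _ hF)
    simpa using h.symm
  refine ⟨fun k t ht => ?_, fun k N hN => ?_, fun Ω hΩ => ⟨?_, fun N hN => ?_⟩,
    fun F _ => trivial, fun F hF => ⟨fun y => σ.tileMeasure_translate v T y F, hinflate F hF,
      fun θ hθ => ⟨?_, σ.tileMeasure_smul hT v θ (hΦ hT v hF)⟩⟩⟩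
  · simpa using (σ.tileMeasure_patch hT v k (singleton_subset_iff.mpr ht) (finite_singleton t)
      (empty_subset _) (empty_subset _)).2
  · simpa using (σ.tileMeasure_patch hT v k (empty_subset _) finite_empty (empty_subset _) hN).2
  · exact σ.tendsto_tileMeasure_packing hd hT v
      (TileSubstitution.lipschitzRing_subset_minkowskiRing (TileSubstitution.mem_lipschitzRing hΩ))
  -- The boundary of an open set has empty interior, so `N` contains no cell; it is also disjoint
  -- from Ω, and additivity applies.
  · have hN0 : interior N = ∅ := by
      rw [← subset_empty_iff, ← interior_frontier hΩ.isOpen.isClosed_compl, frontier_compl]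
      exact interior_mono hN
    have hNmem : N ∈ lipschitzRing d := fun _ _ h => (h Ω hΩ).2 N hN
    have hdis : Disjoint Ω N := (disjoint_frontier_iff_isOpen.mpr hΩ.isOpen).symm.mono_right hN
    have h := hT.isCellHierarchy.limUnder_cellSum_union (hM v)
      (hΦ hT v (TileSubstitution.mem_lipschitzRing hΩ)) (hΦ hT v hNmem) hdis
    change σ.tileMeasure v T (Ω ∪ N) = σ.tileMeasure v T Ω + σ.tileMeasure v T N at h
    rw [h, σ.tileMeasure_eq_zero hN0, add_zero]
  · rw [← hinflate F hF, hθ]
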